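/- Let $d\in\mathbb N=\{1,2,\dots\}$. For $\kappa\in[0,\infty)^d$ let $S_\kappa:=\{z=x+\mathrm iy\in\mathbb C^d: |y_j|<\kappa_j,\ j=1,\dots,d\}$. Let $\tau\in(0,\infty)^d$ and let $f:\mathbb R^d\to\mathbb R$ have a holomorphic extension to $S_\tau$, again denoted by $f$, such that for every $\beta\in\mathbb R^d$ with $0\le\beta\le\tau$ (componentwise) there is $B(\beta)>0$ with $$|f(x+\mathrm iy)|\le B(\beta)\exp\Big(\sum_{j=1}^d\Big(\frac{x_j^2}{4}-2^{-1/2}|x_j|\big(\beta_j^2-\tfrac12y_j^2\big)^{1/2}\Big)\Big)\qquad\text{for all }x+\mathrm iy\in S_\beta .$$ Then for every $\beta$ with $0<\beta_j<\tau_j$ for all $j$ there exists $C>0$, depending only on $d$, $\beta$ and the value $B(\beta)$, such that for every integer $N\ge1$ there is a ReLU network $\tilde f_N:\mathbb R^d\to\mathbb R$ with $$\operatorname{size}(\tilde f_N)\le CN(1+\log N),\qquad \operatorname{depth}(\tilde f_N)\le CN^{\frac3{2d+7}}(1+\log N)^2,$$ $$\|f-\tilde f_N\|_{L^2(\mathbb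 R^d,\gamma_d)}\le C\exp\Big(-2^{-1/2}\,\delta(\beta)\,N^{\frac1{2d+7}}\Big),\qquad \delta(\beta):=\Big(\prod_{j=1}^d\beta_j\Big)^{1/d}.$$ Here $\gamma_d$ is the standard Gaussian measure on $\mathbb R^d$, and a ReLU network of depth $L\in\{0,1,2,\dots\}$ is a map $A_L\circ\sigma\circ A_{L-1}\circ\cdots\circ\sigma\circ A_0$ with affine maps $A_j(x)=W_jx+b_j$ between Euclidean spaces $\mathbb R^{n_j}\to\mathbb R^{n_{j+1}}$ and $\sigma(t)=\max\{t,0\}$ applied componentwise; its size is the total number of nonzero entries of all $W_j$ and $b_j$. -/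

import Mathlib

open MeasureTheory ProbabilityTheory

noncomputable section

/-- A feedforward network architecture with weights, from `ℝ ^ m` to `ℝ ^ nOut`: a composition
`A_L ∘ σ ∘ ⋯ ∘ σ ∘ A_0` of affine maps `x ↦ W x + b`, listed from the input side, without skip
connections. The input dimension `m` is the index, the hidden widths are arbitrary. -/
inductive FeedForward (nOut : ℕ) : ℕ → Type
  | output {m : ℕ} (W : Matrix (Fin nOut) (Fin m) ℝ) (b : Fin nOut → ℝ) : FeedForward nOut m
  | hidden {m k : ℕ} (W : Matrix (Fin k) (Fin m) ℝ) (b : Fin k → ℝ)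
      (next : FeedForward nOut k) : FeedForward nOut m

namespace FeedForward

/-- The map realized by the network when the activation `σ` is applied componentwise. -/
def realize (σ : ℝ → ℝ) {nOut : ℕ} : {m : ℕ} → FeedForward nOut m →
    (Fin m → ℝ) → (Fin nOut → ℝ)
  | _, output W b, x => W.mulVec x + b
  | _, hidden W b next, x => next.realize σ (fun k => σ ((W.mulVec x + b) k))

/-- The depth: the number of applications of the activation function. -/
def depth {nOut : ℕ} : {m : ℕ} → FeedForward nOut m → ℕ
  | _, output _ _ => 0
  | _, hidden _ _ next => next.depth + 1

/-- The number of nonzero entries of a weight matrix and a bias vector. -/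
def layerSize {m k : ℕ} (W : Matrix (Fin k) (Fin m) ℝ) (b : Fin k → ℝ) : ℕ :=
  Set.ncard {p : Fin k × Fin m | W p.1 p.2 ≠ 0} + Set.ncard {i : Fin k | b i ≠ 0}

/-- The size: the number of nonzero weights and biases in the network. -/
def size {nOut : ℕ} : {m : ℕ} → FeedForward nOut m → ℕ
  | _, output W b => layerSize W b
  | _, hidden W b next => layerSize W b + next.size

end FeedForward

/-- The activation function `x ↦ max {x, 0}`. -/
def relu (x : ℝ) : ℝ := max x 0

/-- The standard Gaussian measure on `ℝ ^ d`. -/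
def stdGaussianMeasure (d : ℕ) : Measure (Fin d → ℝ) :=
  Measure.pi fun _ => gaussianReal 0 1

/-- The product of the open strips `{z ∈ ℂ | |Im z| < κ j}`. -/
def stripProduct {d : ℕ} (κ : Fin d → ℝ) : Set (Fin d → ℂ) :=
  {z | ∀ j, |(z j).im| < κ j}

/-- `f : ℝ ^ d → ℝ` extends holomorphically to the product of strips of half-widths
`τ ∈ (0, ∞) ^ d`, and for every `0 ≤ β ≤ τ` the extension satisfies, with the constant `B β > 0`,
`|f (x + i y)| ≤ B β exp (∑ j, (x j ^ 2 / 4 - 2 ^ (-1 / 2) |x j| (β j ^ 2 - y j ^ 2 / 2) ^ (1 / 2)))`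
on the product of strips of half-widths `β`. -/
def AnalyticWithGrowth {d : ℕ} (τ : Fin d → ℝ) (B : (Fin d → ℝ) → ℝ)
    (f : (Fin d → ℝ) → ℝ) : Prop :=
  (∀ j, 0 < τ j) ∧
  ∃ F : (Fin d → ℂ) → ℂ,
    DifferentiableOn ℂ F (stripProduct τ) ∧
    (∀ x : Fin d → ℝ, F (fun j => (x j : ℂ)) = (f x : ℂ)) ∧
    ∀ β : Fin d → ℝ, (∀ j, 0 ≤ β j) → (∀ j, β j ≤ τ j) →
      0 < B β ∧
      ∀ z ∈ stripProduct β,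
        ‖F z‖ ≤ B β * Real.exp (∑ j, ((z j).re ^ 2 / 4 -
          (2 : ℝ) ^ (-(1 / 2) : ℝ) * |(z j).re| * Real.sqrt (β j ^ 2 - (z j).im ^ 2 / 2)))

/-- The geometric mean of `β 0, …, β (d - 1)`. -/
def geomMean {d : ℕ} (β : Fin d → ℝ) : ℝ :=
  (∏ j, β j) ^ (1 / (d : ℝ))

end

/-! Put `S = N ^ (1 / (2 * d + 7))`. The function is interpolated by polynomials on the cells of a
uniform grid whose mesh `h` does not depend on `N`. With about `S` cells per direction and degree
about `S`, the error is `O(exp (-κ S))` for any prescribed `κ`; the stated rate is one choice of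
`κ`.

Truncation: let `r = min β` and `α = r / 4`. The growth bound at `y = 0` gives decay `exp (-2 α ∑ |x
j|)` relative to `exp (∑ x j ^ 2 / 4)`. Half of it makes `f` small off a box of half-width `M h`;
the other half makes the error weight `expWeight α` square integrable for the Gaussian measure.

Interpolation: one-variable interpolation at `p` equispaced nodes amplifies errors by at most `exp
(4 p)`, and holomorphy in discs of radius `r` gives the factor `(2 h / r) ^ p`. A small fixed `h`
makes the second win, even after tensorization, and the growth of `f` relative to the weight costs
only `exp (O(S))` on the box. Hat functions glue the cells together (`abs_sub_cellApprox_le`).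

Network: the glued interpolant is a sum of `(2 M + 1) ^ d * p ^ d` weighted products of `d p`
one-variable factors bounded by `1` (`exists_feedForward_cellApprox`). The coefficients may be as
large as `exp (O(S ^ 2))`, so each multiplication gets about `S ^ 2` layers. Depth is then `O(S ^
3)` and size `O(S ^ (2 d + 3))`, below `S ^ (2 d + 7) = N` in order; the logarithms are not needed.
-/

namespace Matrix

/-! ### Block matrices. -/

/-- Two matrices on top of each other. -/
def vcat {k₁ k₂ m : ℕ} (A : Matrix (Fin k₁) (Fin m) ℝ) (B : Matrix (Fin k₂) (Fin m) ℝ) :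
    Matrix (Fin (k₁ + k₂)) (Fin m) ℝ :=
  of fun i j => Fin.append (fun i => A i j) (fun i => B i j) i

/-- Two matrices side by side. -/
def hcat {k m₁ m₂ : ℕ} (A : Matrix (Fin k) (Fin m₁) ℝ) (B : Matrix (Fin k) (Fin m₂) ℝ) :
    Matrix (Fin k) (Fin (m₁ + m₂)) ℝ :=
  of fun i j => Fin.append (A i) (B i) j

section
variable {k k₁ k₂ m m₁ m₂ : ℕ} (A : Matrix (Fin k₁) (Fin m) ℝ) (B : Matrix (Fin k₂) (Fin m) ℝ)
  (A' : Matrix (Fin k) (Fin m₁) ℝ) (B' : Matrix (Fin k) (Fin m₂) ℝ)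

@[simp] lemma vcat_left (i : Fin k₁) (j : Fin m) : vcat A B (Fin.castAdd k₂ i) j = A i j := by
  simp [vcat]

@[simp] lemma vcat_right (i : Fin k₂) (j : Fin m) : vcat A B (Fin.natAdd k₁ i) j = B i j := by
  simp [vcat]

@[simp] lemma hcat_left (i : Fin k) (j : Fin m₁) : hcat A' B' i (Fin.castAdd m₂ j) = A' i j := by
  simp [hcat]

@[simp] lemma hcat_right (i : Fin k) (j : Fin m₂) : hcat A' B' i (Fin.natAdd m₁ j) = B' i j := by
  simp [hcat]

lemma vcat_mulVec (x : Fin m → ℝ) :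
    (vcat A B).mulVec x = Fin.append (A.mulVec x) (B.mulVec x) := by
  ext i
  refine Fin.addCases (fun i => ?_) (fun i => ?_) i <;> simp [mulVec, dotProduct]

lemma hcat_mulVec (x : Fin m₁ → ℝ) (y : Fin m₂ → ℝ) :
    (hcat A' B').mulVec (Fin.append x y) = A'.mulVec x + B'.mulVec y := by
  ext i
  simp [mulVec, dotProduct, Fin.sum_univ_add]

end

end Matrix

/-! ### Sums of networks of equal depth. -/

namespace FeedForward

lemma layerSize_eq {m k : ℕ} (W : Matrix (Fin k) (Fin m) ℝ) (b : Fin k → ℝ) :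
    layerSize W b = (∑ i, ∑ j, if W i j ≠ 0 then 1 else 0) + ∑ i, if b i ≠ 0 then 1 else 0 := by
  classical
  unfold layerSize
  rw [Set.ncard_eq_toFinset_card', Set.ncard_eq_toFinset_card', Set.toFinset_ofPred,
    Set.toFinset_ofPred, Finset.card_filter, Finset.card_filter, ← Finset.univ_product_univ,
    Finset.sum_product]

lemma layerSize_le {m k : ℕ} (W : Matrix (Fin k) (Fin m) ℝ) (b : Fin k → ℝ) :
    layerSize W b ≤ k * m + k := by
  rw [layerSize_eq]
  refine add_le_add ?_ ?_
  · refine (Finset.sum_le_sum fun i _ => Finset.sum_le_sum (g := fun _ => 1) fun j _ => ?_).trans ?_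
    · split_ifs <;> simp
    · simp
  · refine (Finset.sum_le_sum (g := fun _ => 1) fun i _ => ?_).trans ?_
    · split_ifs <;> simp
    · simp

/-- Two networks of equal depth can be run side by side on separate inputs, adding the outputs. -/
lemma exists_par (σ : ℝ → ℝ) {n m₁ : ℕ} (Φ : FeedForward n m₁) :
    ∀ {m₂ : ℕ} (Ψ : FeedForward n m₂), Φ.depth = Ψ.depth →
      ∃ Θ : FeedForward n (m₁ + m₂), Θ.depth = Φ.depth ∧ Θ.size ≤ Φ.size + Ψ.size ∧
        ∀ x y, Θ.realize σ (Fin.append x y) = Φ.realize σ x + Ψ.realize σ y := by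
  induction Φ with
  | @output m₁ W b =>
    intro m₂ Ψ h
    cases Ψ with
    | hidden W' b' next' => simp [depth] at h
    | output W' b' =>
      refine ⟨output (W.hcat W') (b + b'), rfl, ?_, ?_⟩
      · simp only [size, layerSize_eq, Fin.sum_univ_add, Matrix.hcat_left, Matrix.hcat_right,
          Finset.sum_add_distrib]
        have : (∑ i, if (b + b') i ≠ 0 then 1 else 0) ≤
            (∑ i, if b i ≠ 0 then 1 else 0) + ∑ i, if b' i ≠ 0 then 1 else 0 := by
          rw [← Finset.sum_add_distrib]
          refine Finset.sum_le_sum fun i _ => ?_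
          by_cases h1 : b i = 0 <;> by_cases h2 : b' i = 0 <;> simp [h1, h2]
          split_ifs <;> simp
        omega
      · intro x y
        simp only [realize, Matrix.hcat_mulVec]
        abel
  | @hidden m₁ k₁ W b next ih =>
    intro m₂ Ψ h
    cases Ψ with
    | output W' b' => simp [depth] at h
    | @hidden _ k₂ W' b' next' =>
      obtain ⟨Θ, h1, h2, h3⟩ := ih next' (by simpa [depth] using h)
      refine ⟨hidden ((W.hcat 0).vcat (Matrix.hcat 0 W'))
        (Fin.append b b') Θ, by simp [depth, h1], ?_, ?_⟩
      · simp only [size, layerSize_eq, Fin.sum_univ_add, Fin.append_left, Fin.append_right,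
          Matrix.vcat_left, Matrix.vcat_right, Matrix.hcat_left, Matrix.hcat_right]
        simp only [Matrix.zero_apply, ne_eq, not_true_eq_false, if_false, Finset.sum_const_zero,
          add_zero, zero_add] at h2 ⊢
        omega
      · intro x y
        simp only [realize]
        rw [← h3]
        congr 1
        ext i
        refine Fin.addCases (fun i => ?_) (fun i => ?_) i <;>
          simp [Matrix.vcat_mulVec, Matrix.hcat_mulVec]

/-- The sum of two networks of equal depth. -/
lemma exists_add (σ : ℝ → ℝ) {n m : ℕ} (Φ Ψ : FeedForward n m) (h : Φ.depth = Ψ.depth) :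
    ∃ Θ : FeedForward n m, Θ.depth = Φ.depth ∧ Θ.size ≤ Φ.size + Ψ.size ∧
      ∀ x, Θ.realize σ x = Φ.realize σ x + Ψ.realize σ x := by
  cases Φ with
  | output W b =>
    cases Ψ with
    | hidden W' b' next' => simp [depth] at h
    | output W' b' =>
      refine ⟨output (W + W') (b + b'), rfl, ?_, ?_⟩
      · simp only [size, layerSize_eq, ← Finset.sum_add_distrib]
        have key : ∀ u v : ℝ, (if u + v ≠ 0 then 1 else 0) ≤
            (if u ≠ 0 then 1 else 0) + (if v ≠ 0 then 1 else 0) := by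
          intro u v
          by_cases h1 : u = 0 <;> by_cases h2 : v = 0 <;> simp [h1, h2]
          split_ifs <;> simp
        refine Finset.sum_le_sum fun i _ => ?_
        have h1 := Finset.sum_le_sum (s := Finset.univ) fun j _ => key (W i j) (W' i j)
        rw [Finset.sum_add_distrib] at h1
        have h2 := key (b i) (b' i)
        simp only [Matrix.add_apply, Pi.add_apply]
        refine (add_le_add h1 h2).trans (le_of_eq ?_)
        ring
      · intro x
        simp only [realize, Matrix.add_mulVec]
        abel
  | @hidden _ k₁ W b next =>
    cases Ψ with
    | output W' b' => simp [depth] at h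
    | @hidden _ k₂ W' b' next' =>
      -- Only the first layer shares its input; behind it the two networks read separate vectors.
      obtain ⟨Θ, h1, h2, h3⟩ := exists_par σ next next' (by simpa [depth] using h)
      refine ⟨hidden (W.vcat W') (Fin.append b b') Θ, by simp [depth, h1], ?_, ?_⟩
      · simp only [size, layerSize_eq, Fin.sum_univ_add, Fin.append_left, Fin.append_right,
          Matrix.vcat_left, Matrix.vcat_right]
        omega
      · intro x
        simp only [realize]
        rw [← h3]
        congr 1
        ext i
        refine Fin.addCases (fun i => ?_) (fun i => ?_) i <;> simp [Matrix.vcat_mulVec]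

/-- Layers of width zero cost nothing, so the empty sum is available at every depth, whatever `σ 0`
is. -/
lemma exists_zero (σ : ℝ → ℝ) (n L : ℕ) : ∀ m, ∃ Θ : FeedForward n m,
    Θ.depth = L ∧ Θ.size = 0 ∧ ∀ x, Θ.realize σ x = 0 := by
  induction L with
  | zero => exact fun m => ⟨output 0 0, rfl, by simp [size, layerSize], by simp [realize]⟩
  | succ L ih =>
    intro m
    obtain ⟨Θ, h1, h2, h3⟩ := ih 0
    exact ⟨hidden 0 0 Θ, by simp [depth, h1], by simp [size, layerSize, h2],
      fun x => by simp only [realize, h3]⟩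

/-- A finite sum of networks of equal depth. -/
lemma exists_sum (σ : ℝ → ℝ) {n m L s : ℕ} {ι : Type*} (I : Finset ι)
    (g : ι → (Fin m → ℝ) → (Fin n → ℝ))
    (h : ∀ i ∈ I, ∃ Φ : FeedForward n m, Φ.depth = L ∧ Φ.size ≤ s ∧ ∀ x, Φ.realize σ x = g i x) :
    ∃ Φ : FeedForward n m, Φ.depth = L ∧ Φ.size ≤ I.card * s ∧
      ∀ x, Φ.realize σ x = ∑ i ∈ I, g i x := by
  classical
  induction I using Finset.induction_on with
  | empty =>
    obtain ⟨Θ, h1, h2, h3⟩ := exists_zero σ n L m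
    exact ⟨Θ, h1, by simp [h2], by simpa using h3⟩
  | insert a I ha ih =>
    obtain ⟨Φ, h1, h2, h3⟩ := h a (Finset.mem_insert_self a I)
    obtain ⟨Ψ, h4, h5, h6⟩ := ih fun i hi => h i (Finset.mem_insert_of_mem hi)
    obtain ⟨Θ, h7, h8, h9⟩ := exists_add σ Φ Ψ (h1.trans h4.symm)
    refine ⟨Θ, h7.trans h1, ?_, fun x => ?_⟩
    · rw [Finset.card_insert_of_notMem ha, add_mul, one_mul]
      omega
    · rw [h9, h3, h6, Finset.sum_insert ha]

/-! ### Networks of bounded width, built backwards from the output. -/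

/-- All hidden layers have width at most `w`. -/
def IsNarrow (w : ℕ) {n : ℕ} : {m : ℕ} → FeedForward n m → Prop
  | _, output _ _ => True
  | _, hidden (k := k) _ _ next => k ≤ w ∧ next.IsNarrow w

lemma IsNarrow.size_le {w n : ℕ} (hn : n ≤ w) {m : ℕ} {Φ : FeedForward n m} (hm : m ≤ w)
    (h : Φ.IsNarrow w) : Φ.size ≤ (Φ.depth + 1) * (w * w + w) := by
  induction Φ with
  | output W b =>
    simp only [size, depth, zero_add, one_mul]
    exact (layerSize_le W b).trans (by gcongr)
  | hidden W b next ih =>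
    obtain ⟨h1, h2⟩ := h
    have h3 := ih h1 h2
    have h4 : layerSize W b ≤ w * w + w := (layerSize_le W b).trans (by gcongr)
    simp only [size, depth]
    linarith

/-- Precomposition with an affine map. -/
def precomp {n m m' : ℕ} (M : Matrix (Fin m) (Fin m') ℝ) (c : Fin m → ℝ) :
    FeedForward n m → FeedForward n m'
  | output W b => output (W * M) (W.mulVec c + b)
  | hidden W b next => hidden (W * M) (W.mulVec c + b) next

section precomp
variable {n m m' : ℕ} (M : Matrix (Fin m) (Fin m') ℝ) (c : Fin m → ℝ) (Φ : FeedForward n m)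

lemma depth_precomp : (Φ.precomp M c).depth = Φ.depth := by
  cases Φ <;> rfl

lemma isNarrow_precomp {w : ℕ} (h : Φ.IsNarrow w) : (Φ.precomp M c).IsNarrow w := by
  cases Φ <;> exact h

lemma realize_precomp (σ : ℝ → ℝ) (x : Fin m' → ℝ) :
    (Φ.precomp M c).realize σ x = Φ.realize σ (M.mulVec x + c) := by
  cases Φ <;> simp only [precomp, realize, Matrix.mulVec_add, Matrix.mulVec_mulVec, add_assoc]

end precomp

end FeedForward

/-- `g` is the realization of a ReLU network of depth `L` and width at most `w`. -/
def NarrowNet (w L : ℕ) {m : ℕ} (g : (Fin m → ℝ) → ℝ) : Prop :=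
  ∃ Φ : FeedForward 1 m, Φ.depth = L ∧ Φ.IsNarrow w ∧ ∀ x, Φ.realize relu x 0 = g x

/-- Affine combinations of the coordinates and their absolute values. -/
def AbsAffine {m : ℕ} (g : (Fin m → ℝ) → ℝ) : Prop :=
  ∃ (c : ℝ) (p q : Fin m → ℝ), ∀ s, g s = (∑ j, (p j * |s j| + q j * s j)) + c

namespace AbsAffine
variable {m : ℕ} {g g' : (Fin m → ℝ) → ℝ}

lemma const (c : ℝ) : AbsAffine fun _ : Fin m → ℝ => c :=
  ⟨c, 0, 0, fun s => by simp⟩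

lemma coord (i : Fin m) : AbsAffine fun s : Fin m → ℝ => s i :=
  ⟨0, 0, Pi.single i 1, fun s => by simp [Pi.single_apply]⟩

lemma abs_coord (i : Fin m) : AbsAffine fun s : Fin m → ℝ => |s i| :=
  ⟨0, Pi.single i 1, 0, fun s => by simp [Pi.single_apply]⟩

lemma add (h : AbsAffine g) (h' : AbsAffine g') : AbsAffine fun s => g s + g' s := by
  obtain ⟨c, p, q, h⟩ := h
  obtain ⟨c', p', q', h'⟩ := h'
  refine ⟨c + c', p + p', q + q', fun s => ?_⟩
  simp only [h, h']
  rw [add_add_add_comm, ← Finset.sum_add_distrib]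
  congr 1
  refine Finset.sum_congr rfl fun j _ => ?_
  simp only [Pi.add_apply]
  ring

lemma const_mul (a : ℝ) (h : AbsAffine g) : AbsAffine fun s => a * g s := by
  obtain ⟨c, p, q, h⟩ := h
  refine ⟨a * c, fun j => a * p j, fun j => a * q j, fun s => ?_⟩
  simp only [h]
  rw [mul_add, Finset.mul_sum]
  congr 1
  refine Finset.sum_congr rfl fun j _ => ?_
  ring

end AbsAffine

lemma relu_sub_relu_neg (t : ℝ) : relu t - relu (-t) = t := by
  unfold relu
  rcases le_total 0 t with h | h
  · rw [max_eq_left h, max_eq_right (by linarith)]; ring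
  · rw [max_eq_right h, max_eq_left (by linarith)]; ring

lemma relu_add_relu_neg (t : ℝ) : relu t + relu (-t) = |t| := by
  unfold relu
  rcases le_total 0 t with h | h
  · rw [max_eq_left h, max_eq_right (by linarith), abs_of_nonneg h]; ring
  · rw [max_eq_right h, max_eq_left (by linarith), abs_of_nonpos h]; ring

namespace NarrowNet

/-- The new layer sits at the input end and stores `relu s` and `relu (-s)`. Since `p |s| + q s = (p
+ q) relu s + (p - q) relu (-s)`, the map `f` merges with the first affine map of the network for
`g`. -/
lemma comp_step {w L m k : ℕ} (hw : m + m ≤ w) {g : (Fin k → ℝ) → ℝ} (hg : NarrowNet w L g)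
    {f : (Fin m → ℝ) → (Fin k → ℝ)} (hf : ∀ i, AbsAffine fun s => f s i) :
    NarrowNet w (L + 1) fun s => g (f s) := by
  obtain ⟨Φ, h1, h2, h3⟩ := hg
  choose c p q hf using hf
  refine ⟨.hidden (Matrix.vcat 1 (-1)) 0
    (Φ.precomp (Matrix.hcat (Matrix.of (p + q)) (Matrix.of (p - q))) c), ?_, ?_, fun x => ?_⟩
  · rw [FeedForward.depth, FeedForward.depth_precomp, h1]
  · rw [FeedForward.IsNarrow]
    exact ⟨hw, FeedForward.isNarrow_precomp _ _ _ h2⟩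
  · simp only [FeedForward.realize]
    have e : (fun k => relu ((Matrix.mulVec (Matrix.vcat (1 : Matrix (Fin m) (Fin m) ℝ) (-1)) x
        + 0) k)) = Fin.append (fun j => relu (x j)) (fun j => relu (-x j)) := by
      rw [Matrix.vcat_mulVec]
      ext i
      refine Fin.addCases (fun i => ?_) (fun i => ?_) i <;>
        simp only [Matrix.neg_mulVec, Matrix.one_mulVec, add_zero, Fin.append_left,
          Fin.append_right, Pi.neg_apply]
    rw [e, FeedForward.realize_precomp, h3, Matrix.hcat_mulVec]
    congr 1
    ext i
    refine Eq.trans ?_ (hf i x).symm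
    rw [Pi.add_apply, Pi.add_apply]
    congr 1
    simp only [Matrix.mulVec, dotProduct, Matrix.of_apply, Pi.add_apply, Pi.sub_apply]
    rw [← Finset.sum_add_distrib]
    refine Finset.sum_congr rfl fun j _ => ?_
    have e1 := relu_add_relu_neg (x j)
    have e2 := relu_sub_relu_neg (x j)
    rw [← e1]
    linear_combination q i j * e2

lemma comp_affine {w L m k : ℕ} {g : (Fin k → ℝ) → ℝ} (hg : NarrowNet w L g)
    (M : Matrix (Fin k) (Fin m) ℝ) (c : Fin k → ℝ) :
    NarrowNet w L fun s => g (M.mulVec s + c) := by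
  obtain ⟨Φ, h1, h2, h3⟩ := hg
  exact ⟨Φ.precomp M c, by rw [FeedForward.depth_precomp, h1],
    FeedForward.isNarrow_precomp _ _ _ h2, fun x => by rw [FeedForward.realize_precomp, h3]⟩

end NarrowNet

/-! ### Approximate squares and products. -/

/-- Up to an additive constant, the piecewise linear interpolant of `u ↦ u ^ 2` on `[-1, 1]` at
`2 ^ n + 1` equispaced nodes. -/
noncomputable def sqApprox : ℕ → ℝ → ℝ
  | 0, _ => 0
  | n + 1, u => |u| + sqApprox n (2 * |u| - 1) / 4

/-- The identity `u ^ 2 = |u| + ((2 |u| - 1) ^ 2 - 1) / 4` divides the error by four at each step.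
-/
lemma sqApprox_bounds (n : ℕ) {u : ℝ} (hu : |u| ≤ 1) :
    u ^ 2 ≤ sqApprox n u - 1 / 3 + 4 / 3 * (1 / 4) ^ n ∧
      sqApprox n u - 1 / 3 + 4 / 3 * (1 / 4) ^ n ≤ 1 ∧
      sqApprox n u - 1 / 3 + 4 / 3 * (1 / 4) ^ n ≤ u ^ 2 + (1 / 4) ^ n := by
  induction n generalizing u with
  | zero =>
    have h : u ^ 2 ≤ 1 := by rwa [sq_le_one_iff_abs_le_one]
    have h0 := sq_nonneg u
    simp only [sqApprox, pow_zero]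
    refine ⟨?_, ?_, ?_⟩ <;> linarith
  | succ n ih =>
    have h0 := abs_nonneg u
    have hw : |2 * |u| - 1| ≤ 1 := by
      rw [abs_le]; constructor <;> linarith
    obtain ⟨h1, h2, h3⟩ := ih hw
    have e : (2 * |u| - 1) ^ 2 = 4 * u ^ 2 - 4 * |u| + 1 := by
      rw [← sq_abs u]; ring
    rw [e] at h1 h3
    simp only [sqApprox, pow_succ]
    refine ⟨?_, ?_, ?_⟩ <;> linarith

/-- The iteration computing `a + c * (sqApprox n u - sqApprox n v)`. -/
noncomputable def sqLoop : ℕ → ℝ → ℝ → ℝ → ℝ → ℝ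
  | 0, _, _, _, a => a
  | n + 1, c, u, v, a => sqLoop n (c / 4) (2 * |u| - 1) (2 * |v| - 1) (a + c * (|u| - |v|))

lemma sqLoop_eq (n : ℕ) (c u v a : ℝ) :
    sqLoop n c u v a = a + c * (sqApprox n u - sqApprox n v) := by
  induction n generalizing c u v a with
  | zero => simp [sqLoop, sqApprox]
  | succ n ih => rw [sqLoop, ih, sqApprox, sqApprox]; ring

/-- Approximate multiplication by polarization. -/
noncomputable def approxMul (n : ℕ) (y v : ℝ) : ℝ :=
  sqLoop n 1 ((y + v) / 2) ((y - v) / 2) 0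

/-- The additive constants of the two squares cancel. Both approximate squares lie in `[0, 1]`, so
the product stays in `[-1, 1]` and can be multiplied again. -/
lemma approxMul_bounds (n : ℕ) {y v : ℝ} (hy : |y| ≤ 1) (hv : |v| ≤ 1) :
    |approxMul n y v| ≤ 1 ∧ |approxMul n y v - y * v| ≤ (1 / 4) ^ n := by
  rw [abs_le] at hy hv
  obtain ⟨h1, h2, h3⟩ := sqApprox_bounds n (u := (y + v) / 2) (by
    rw [abs_le]; constructor <;> linarith)
  obtain ⟨h4, h5, h6⟩ := sqApprox_bounds n (u := (y - v) / 2) (by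
    rw [abs_le]; constructor <;> linarith)
  have h7 := sq_nonneg ((y + v) / 2)
  have h8 := sq_nonneg ((y - v) / 2)
  have e : y * v = ((y + v) / 2) ^ 2 - ((y - v) / 2) ^ 2 := by ring
  rw [approxMul, sqLoop_eq, e, abs_le, abs_le]
  refine ⟨⟨?_, ?_⟩, ?_, ?_⟩ <;> linarith

/-- Approximate product of a list of functions, with starting value `y`. -/
noncomputable def approxProd {α : Type*} (n : ℕ) : List (α → ℝ) → α → ℝ → ℝ
  | [], _, y => y
  | v :: l, x, y => approxProd n l x (approxMul n y (v x))

/-- As all factors and partial products are bounded by `1`, the errors of the multiplications merely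
add. The exact partial product `y'` is carried along by the induction. -/
lemma approxProd_sub_le {α : Type*} (n : ℕ) (l : List (α → ℝ)) (x : α)
    (hl : ∀ v ∈ l, |v x| ≤ 1) {y y' : ℝ} (hy : |y| ≤ 1) :
    |approxProd n l x y - y' * (l.map fun v => v x).prod| ≤
      |y - y'| + l.length * (1 / 4) ^ n := by
  induction l generalizing y y' with
  | nil => simp [approxProd]
  | cons v l ih =>
    have hv := hl v List.mem_cons_self
    obtain ⟨h1, h2⟩ := approxMul_bounds n hy hv
    have h3 := ih (fun w hw => hl w (List.mem_cons_of_mem _ hw)) h1 (y' := y' * v x)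
    rw [approxProd, List.map_cons, List.prod_cons, ← mul_assoc]
    refine h3.trans ?_
    have h4 : |approxMul n y (v x) - y' * v x| ≤ (1 / 4) ^ n + |y - y'| := by
      have e : approxMul n y (v x) - y' * v x =
        (approxMul n y (v x) - y * v x) + (y - y') * v x := by ring
      rw [e]
      refine (abs_add_le _ _).trans (add_le_add h2 ?_)
      rw [abs_mul]
      exact mul_le_of_le_one_right (abs_nonneg _) hv
    rw [List.length_cons]
    push_cast
    linarith

/-! ### Networks for products of one-variable factors. -/

/-- Functions of one coordinate that are combinations of three absolute values of affine
functions and a constant. -/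
def IsFactor {d : ℕ} (v : (Fin d → ℝ) → ℝ) : Prop :=
  ∃ (j : Fin d) (κ c : ℝ) (e α : Fin 3 → ℝ), ∀ x, v x = c + ∑ k, α k * |κ * x j + e k|

namespace NarrowNet

variable {d w L : ℕ}

/-- The first `d` channels transport `x` unchanged. Of the other four, number `0` is the
accumulator, `1` and `2` hold the arguments of `sqLoop`, and `3` is used only while a factor is
evaluated. -/
lemma comp_slots (hw : (d + 4) + (d + 4) ≤ w) {g : (Fin (d + 4) → ℝ) → ℝ} (hg : NarrowNet w L g)
    {V : (Fin (d + 4) → ℝ) → (Fin 4 → ℝ)} (hV : ∀ i, AbsAffine fun s => V s i) :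
    NarrowNet w (L + 1) fun s => g (Fin.append (fun j => s (Fin.castAdd 4 j)) (V s)) := by
  refine hg.comp_step hw fun i => ?_
  refine Fin.addCases (fun i => ?_) (fun i => ?_) i
  · simp only [Fin.append_left]
    exact AbsAffine.coord _
  · simp only [Fin.append_right]
    exact hV i

lemma comp_sqLoop (hw : (d + 4) + (d + 4) ≤ w) {G : (Fin d → ℝ) → ℝ → ℝ}
    (hG : NarrowNet w L fun s : Fin (d + 4) → ℝ =>
      G (fun j => s (Fin.castAdd 4 j)) (s (Fin.natAdd d 0))) (n : ℕ) :
    ∀ c : ℝ, NarrowNet w (L + n) fun s : Fin (d + 4) → ℝ => G (fun j => s (Fin.castAdd 4 j))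
      (sqLoop n c (s (Fin.natAdd d 1)) (s (Fin.natAdd d 2)) (s (Fin.natAdd d 0))) := by
  induction n with
  | zero => exact fun c => hG
  | succ n ih =>
    intro c
    have h := (ih (c / 4)).comp_slots hw
      (V := fun s => ![s (Fin.natAdd d 0) + c * (|s (Fin.natAdd d 1)| + (-1) * |s (Fin.natAdd d 2)|),
        2 * |s (Fin.natAdd d 1)| + (-1), 2 * |s (Fin.natAdd d 2)| + (-1), 0]) (by
        intro i
        fin_cases i
        · exact (AbsAffine.coord _).add (((AbsAffine.abs_coord _).add
            ((AbsAffine.abs_coord _).const_mul _)).const_mul _)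
        · exact ((AbsAffine.abs_coord _).const_mul _).add (AbsAffine.const _)
        · exact ((AbsAffine.abs_coord _).const_mul _).add (AbsAffine.const _)
        · exact AbsAffine.const _)
    refine (congrArg (NarrowNet w (L + n + 1)) (funext fun s => ?_)).mp h
    simp only [Fin.append_left, Fin.append_right, Matrix.cons_val, sqLoop]
    congr 2
    ring

/-- `G` is the rest of the computation. In order of evaluation, one layer loads the three affine
functions of the factor, one takes their absolute values and forms `(y ± v) / 2` with the
accumulator reset to `0`, and `n` layers run `sqLoop`. -/
lemma comp_factor (hw : (d + 4) + (d + 4) ≤ w) {G : (Fin d → ℝ) → ℝ → ℝ}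
    (hG : NarrowNet w L fun s : Fin (d + 4) → ℝ =>
      G (fun j => s (Fin.castAdd 4 j)) (s (Fin.natAdd d 0))) (n : ℕ)
    {v : (Fin d → ℝ) → ℝ} (hv : IsFactor v) :
    NarrowNet w (L + n + 2) fun s : Fin (d + 4) → ℝ => G (fun j => s (Fin.castAdd 4 j))
      (approxMul n (s (Fin.natAdd d 0)) (v fun j => s (Fin.castAdd 4 j))) := by
  obtain ⟨j, κ, c, e, α, hv⟩ := hv
  have key : ∀ a : ℝ, AbsAffine fun s : Fin (d + 4) → ℝ =>
      (1 / 2) * s (Fin.natAdd d 0) + a * (c + (α 0 * |s (Fin.natAdd d 1)| +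
        (α 1 * |s (Fin.natAdd d 2)| + α 2 * |s (Fin.natAdd d 3)|))) := fun a =>
    ((AbsAffine.coord _).const_mul _).add (((AbsAffine.const _).add
      (((AbsAffine.abs_coord _).const_mul _).add (((AbsAffine.abs_coord _).const_mul _).add
      ((AbsAffine.abs_coord _).const_mul _)))).const_mul _)
  have h1 := (comp_sqLoop hw hG n 1).comp_slots hw
    (V := fun s => ![0, (1 / 2) * s (Fin.natAdd d 0) + (1 / 2) * (c +
        (α 0 * |s (Fin.natAdd d 1)| + (α 1 * |s (Fin.natAdd d 2)| + α 2 * |s (Fin.natAdd d 3)|))),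
      (1 / 2) * s (Fin.natAdd d 0) + (-(1 / 2)) * (c +
        (α 0 * |s (Fin.natAdd d 1)| + (α 1 * |s (Fin.natAdd d 2)| + α 2 * |s (Fin.natAdd d 3)|))),
      0]) (by
      intro i
      fin_cases i
      · exact AbsAffine.const _
      · exact key _
      · exact key _
      · exact AbsAffine.const _)
  have aff : ∀ k, AbsAffine fun s : Fin (d + 4) → ℝ => κ * s (Fin.castAdd 4 j) + e k := fun k =>
    ((AbsAffine.coord _).const_mul _).add (AbsAffine.const _)
  have h2 := h1.comp_slots hw
    (V := fun s => ![s (Fin.natAdd d 0), κ * s (Fin.castAdd 4 j) + e 0,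
      κ * s (Fin.castAdd 4 j) + e 1, κ * s (Fin.castAdd 4 j) + e 2]) (by
      intro i
      fin_cases i
      · exact AbsAffine.coord _
      · exact aff 0
      · exact aff 1
      · exact aff 2)
  convert h2 using 2 with s
  simp only [Fin.append_left, Fin.append_right]
  congr 1
  simp only [Matrix.cons_val, approxMul, hv, Fin.sum_univ_three]
  congr 1 <;> ring

lemma approxProd (hw : (d + 4) + (d + 4) ≤ w) (n : ℕ) (c : ℝ)
    (l : List ((Fin d → ℝ) → ℝ)) (hl : ∀ v ∈ l, IsFactor v) :
    NarrowNet w (l.length * (n + 2)) fun s : Fin (d + 4) → ℝ =>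
      c * approxProd n l (fun j => s (Fin.castAdd 4 j)) (s (Fin.natAdd d 0)) := by
  induction l with
  | nil =>
    refine ⟨.output (Matrix.of fun _ => Pi.single (Fin.natAdd d 0) c) 0, by
      simp [FeedForward.depth], trivial, fun x => ?_⟩
    simp [FeedForward.realize, Matrix.mulVec, _root_.approxProd]
  | cons v l ih =>
    have h := comp_factor hw (G := fun x y => c * _root_.approxProd n l x y)
      (ih fun w hw => hl w (List.mem_cons_of_mem _ hw)) n (hl v List.mem_cons_self)
    rw [List.length_cons, show (l.length + 1) * (n + 2) = l.length * (n + 2) + n + 2 by ring]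
    exact h

end NarrowNet

/-- A weighted approximate product of factors is a network. -/
lemma exists_feedForward_approxProd {d : ℕ} (n : ℕ) (c : ℝ) (l : List ((Fin d → ℝ) → ℝ))
    (hl : ∀ v ∈ l, IsFactor v) :
    ∃ Φ : FeedForward 1 d, Φ.depth = l.length * (n + 2) ∧
      Φ.size ≤ (l.length * (n + 2) + 1) *
        ((2 * d + 8) * (2 * d + 8) + (2 * d + 8)) ∧
      ∀ x, Φ.realize relu x = fun _ => c * approxProd n l x 1 := by
  have h := (NarrowNet.approxProd (w := 2 * d + 8) (by omega) n c l hl).comp_affine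
    -- Copies `x` and starts the accumulator at `1`; the initial values of the other three channels
    -- are irrelevant.
    (Matrix.vcat (1 : Matrix (Fin d) (Fin d) ℝ) (0 : Matrix (Fin 4) (Fin d) ℝ))
    (Fin.append 0 fun _ => 1)
  obtain ⟨Φ, h1, h2, h3⟩ := h
  refine ⟨Φ, h1, ?_, fun x => ?_⟩
  · rw [← h1]
    exact h2.size_le (by omega) (by omega)
  · ext i
    rw [Subsingleton.elim i 0, h3]
    simp only [Matrix.vcat_mulVec, Pi.add_apply, Fin.append_left, Fin.append_right,
      Matrix.one_mulVec, Matrix.zero_mulVec, Pi.zero_apply, add_zero, zero_add]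

/-! ### One-variable interpolation of holomorphic functions. -/

open Polynomial in
/-- Polynomial approximation of a bounded holomorphic function on a disc. -/
lemma exists_polynomial_norm_sub_le {c : ℂ} {r : ℝ} (hr : 0 < r) (p : ℕ) :
    ∀ {M : ℝ} {G : ℂ → ℂ}, DifferentiableOn ℂ G (Metric.ball c r) →
      (∀ z ∈ Metric.ball c r, ‖G z‖ ≤ M) →
      ∃ T : ℂ[X], T.degree < p ∧
        ∀ z ∈ Metric.ball c r, ‖G z - T.eval z‖ ≤ M * (2 * ‖z - c‖ / r) ^ p := by
  induction p with
  | zero => exact fun _ hM => ⟨0, by simp, fun z hz => by simpa using hM z hz⟩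
  | succ p ih =>
    intro M G hG hM
    have hmem : c ∈ Metric.ball c r := Metric.mem_ball_self hr
    have h1 : DifferentiableOn ℂ (dslope G c) (Metric.ball c r) :=
      (Complex.differentiableOn_dslope (Metric.ball_mem_nhds c hr)).2 hG
    -- Schwarz lemma: `G` maps the disc into the closed ball of radius `2 M` about `G c`. Each
    -- divided slope thus costs a factor `2 / r`.
    have h2 : ∀ z ∈ Metric.ball c r, ‖dslope G c z‖ ≤ 2 * M / r := fun z hz =>
      Complex.norm_dslope_le_div_of_mapsTo_ball hG (fun w hw => by
        rw [Metric.mem_closedBall, dist_eq_norm]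
        linarith [norm_sub_le (G w) (G c), hM w hw, hM c hmem]) hz
    obtain ⟨T, hT, hT'⟩ := ih h1 h2
    refine ⟨C (G c) + (X - C c) * T, ?_, fun z hz => ?_⟩
    · rw [degree_lt_iff_coeff_zero] at hT ⊢
      intro m hm
      obtain ⟨k, rfl⟩ : ∃ k, m = k + 1 := ⟨m - 1, by omega⟩
      rw [coeff_add, sub_mul, coeff_sub, coeff_X_mul, coeff_C_mul, coeff_C_of_ne_zero (by omega),
        hT k (by omega), hT (k + 1) (by omega)]
      simp
    · have e : G z - (C (G c) + (X - C c) * T).eval z = (z - c) * (dslope G c z - T.eval z) := by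
        have := sub_smul_dslope G c z
        rw [smul_eq_mul] at this
        simp only [eval_add, eval_C, eval_mul, eval_sub, eval_X]
        linear_combination -this
      rw [e, norm_mul]
      refine (mul_le_mul_of_nonneg_left (hT' z hz) (norm_nonneg _)).trans (le_of_eq ?_)
      rw [pow_succ]
      ring

/-- The `l`-th of `p` equispaced nodes in `[0, 1)`. -/
noncomputable def node (p : ℕ) (l : Fin p) : ℝ := (l : ℕ) / (p : ℝ)

lemma abs_node_le (p : ℕ) (l : Fin p) : |node p l| ≤ 1 := by
  rw [node, abs_of_nonneg (by positivity)]
  exact div_le_one_of_le₀ (by exact_mod_cast l.2.le) (by positivity)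

lemma node_injective (p : ℕ) : Function.Injective (node p) := by
  intro i j h
  have hp : (p : ℝ) ≠ 0 := by
    have := i.2
    exact_mod_cast (by omega : p ≠ 0)
  unfold node at h
  rw [div_left_inj' hp] at h
  exact Fin.ext (by exact_mod_cast h)

/-- The normalization of the Lagrange polynomials. -/
noncomputable def lagWeight (p : ℕ) (i : Fin p) : ℝ :=
  ∏ l ∈ Finset.univ.erase i, 2 / (node p i - node p l)

/-- The value of the `i`-th Lagrange polynomial for the equispaced nodes. -/
noncomputable def lag (p : ℕ) (i : Fin p) (t : ℝ) : ℝ :=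
  lagWeight p i * ∏ l ∈ Finset.univ.erase i, (t - node p l) / 2

lemma prod_erase_range_abs_sub (i n : ℕ) (h : i ≤ n) :
    ∏ l ∈ (Finset.range (n + 1)).erase i, |(i : ℝ) - l| = i.factorial * (n - i).factorial := by
  induction n, h using Nat.le_induction with
  | base =>
    rw [Finset.range_add_one, Finset.erase_insert Finset.notMem_range_self,
      ← Finset.prod_range_reflect, ← Finset.prod_range_add_one_eq_factorial]
    push_cast
    simp only [Nat.sub_self, Nat.factorial_zero, Nat.cast_one, mul_one]
    refine Finset.prod_congr rfl fun l hl => ?_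
    rw [Finset.mem_range] at hl
    rw [show i - 1 - l = i - (l + 1) by omega, Nat.cast_sub (by omega)]
    push_cast
    rw [abs_of_nonneg] <;> ring_nf
    positivity
  | succ n hn ih =>
    rw [Finset.range_add_one, Finset.erase_insert_of_ne (by omega), Finset.prod_insert (by simp),
      ih, show n + 1 - i = (n - i) + 1 by omega, Nat.factorial_succ]
    rw [abs_sub_comm, abs_of_nonneg (by push_cast; linarith [(Nat.cast_le (α := ℝ)).2 hn])]
    push_cast [Nat.cast_sub hn]
    ring

lemma abs_lagWeight (n : ℕ) (i : Fin (n + 1)) :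
    |lagWeight (n + 1) i| = (2 * (n + 1)) ^ n / n.factorial * (n.choose i) := by
  have h1 : ∏ l ∈ Finset.univ.erase i, |((i : ℕ) : ℝ) - (l : ℕ)| =
      (i : ℕ).factorial * (n - i).factorial := by
    rw [← prod_erase_range_abs_sub i n (by omega)]
    refine Finset.prod_bij (fun l _ => (l : ℕ)) ?_ ?_ ?_ ?_
    · intro l hl
      simp only [Finset.mem_erase, Finset.mem_univ, and_true, Finset.mem_range] at hl ⊢
      exact ⟨fun h => hl (Fin.ext h), l.2⟩
    · exact fun a _ b _ h => Fin.ext h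
    · intro b hb
      simp only [Finset.mem_erase, Finset.mem_range] at hb
      exact ⟨⟨b, hb.2⟩, by simp [Fin.ext_iff, hb.1], rfl⟩
    · exact fun _ _ => rfl
  have h2 : ∀ l, |2 / (node (n + 1) i - node (n + 1) l)| =
      (2 * (n + 1)) / |((i : ℕ) : ℝ) - (l : ℕ)| := by
    intro l
    have : (0 : ℝ) < n + 1 := by positivity
    unfold node
    push_cast
    rw [← sub_div, abs_div, abs_div, abs_two, abs_of_pos this]
    field_simp
  have h3 : ((n.choose i : ℕ) : ℝ) * (i : ℕ).factorial * (n - i).factorial = n.factorial := by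
    exact_mod_cast Nat.choose_mul_factorial_mul_factorial (Nat.lt_succ_iff.1 i.2)
  rw [lagWeight, Finset.abs_prod]
  simp only [h2]
  rw [Finset.prod_div_distrib, h1, Finset.prod_const, Finset.card_erase_of_mem (Finset.mem_univ _),
    Finset.card_univ, Fintype.card_fin, Nat.add_sub_cancel, ← h3]
  have h4 : (n.choose i : ℝ) ≠ 0 := by
    exact_mod_cast (Nat.choose_pos (Nat.lt_succ_iff.1 i.2)).ne'
  have h5 : (((i : ℕ).factorial : ℕ) : ℝ) ≠ 0 := by positivity
  have h6 : (((n - i).factorial : ℕ) : ℝ) ≠ 0 := by positivity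
  field_simp

/-- For `p = n + 1` the binomial coefficients sum to `2 ^ n`, which leaves `(4 (n + 1)) ^ n / n!`, a
single term of the series of `exp (4 (n + 1))`. -/
lemma sum_abs_lagWeight_le (p : ℕ) : ∑ i, |lagWeight p i| ≤ Real.exp (4 * p) := by
  cases p with
  | zero => simp
  | succ n =>
    simp only [abs_lagWeight]
    rw [← Finset.mul_sum, Fin.sum_univ_eq_sum_range fun i => ((n.choose i : ℕ) : ℝ)]
    have h : (∑ i ∈ Finset.range (n + 1), ((n.choose i : ℕ) : ℝ)) = 2 ^ n := by
      exact_mod_cast Nat.sum_range_choose n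
    rw [h, div_mul_eq_mul_div, ← mul_pow]
    refine le_trans (le_of_eq ?_) (Real.pow_div_factorial_le_exp (4 * ((n + 1 : ℕ) : ℝ))
      (by positivity) n)
    push_cast
    ring

lemma abs_lag_le (p : ℕ) (i : Fin p) {t : ℝ} (ht : |t| ≤ 1) : |lag p i t| ≤ |lagWeight p i| := by
  rw [lag, abs_mul, Finset.abs_prod]
  refine mul_le_of_le_one_right (abs_nonneg _) (Finset.prod_le_one (fun _ _ => abs_nonneg _) ?_)
  intro l _
  rw [abs_div, abs_two, div_le_one two_pos]
  linarith [abs_sub t (node p l), abs_node_le p l]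

lemma sum_abs_lag_le (p : ℕ) {t : ℝ} (ht : |t| ≤ 1) : ∑ i, |lag p i t| ≤ Real.exp (4 * p) :=
  (Finset.sum_le_sum fun i _ => abs_lag_le p i ht).trans (sum_abs_lagWeight_le p)

open Polynomial in
lemma eval_lagrange_basis (p : ℕ) (i : Fin p) (t : ℝ) :
    (Lagrange.basis Finset.univ (fun l : Fin p => (node p l : ℂ)) i).eval (t : ℂ) =
      (lag p i t : ℂ) := by
  rw [Lagrange.basis, eval_prod, lag, lagWeight, ← Finset.prod_mul_distrib, Complex.ofReal_prod]
  refine Finset.prod_congr rfl fun l _ => ?_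
  rw [Lagrange.basisDivisor]
  simp only [eval_mul, eval_C, eval_sub, eval_X]
  push_cast
  ring

/-- Error of Lagrange interpolation at equispaced nodes for a function with a bounded holomorphic
extension to a disc. -/
lemma abs_sub_lag_le {ρ M : ℝ} (hρ : 1 < ρ) (p : ℕ) {G : ℂ → ℂ} {g : ℝ → ℝ}
    (hG : DifferentiableOn ℂ G (Metric.ball 0 ρ)) (hM : ∀ z ∈ Metric.ball (0 : ℂ) ρ, ‖G z‖ ≤ M)
    (hg : ∀ t : ℝ, |t| ≤ 1 → G t = g t) {t : ℝ} (ht : |t| ≤ 1) :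
    |g t - ∑ i, g (node p i) * lag p i t| ≤ 2 * Real.exp (4 * p) * (M * (2 / ρ) ^ p) := by
  obtain ⟨T, hT, hT'⟩ := exists_polynomial_norm_sub_le (by linarith) p hG hM
  have hM0 : 0 ≤ M := (norm_nonneg _).trans (hM 0 (Metric.mem_ball_self (by linarith)))
  set ε := M * (2 / ρ) ^ p with hε
  have hε0 : 0 ≤ ε := by positivity
  have key : ∀ s : ℝ, |s| ≤ 1 → ‖(g s : ℂ) - T.eval (s : ℂ)‖ ≤ ε := by
    intro s hs
    have h1 : ‖(s : ℂ)‖ ≤ 1 := by rwa [Complex.norm_real]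
    rw [← hg s hs]
    refine (hT' s (by rw [mem_ball_zero_iff]; linarith)).trans ?_
    rw [sub_zero, hε]
    gcongr
    linarith
  -- Interpolation reproduces `T`, so only `g - T` is affected, amplified by the Lebesgue constant.
  have hrep : T.eval (t : ℂ) = ∑ i, T.eval (node p i : ℂ) * (lag p i t : ℂ) := by
    have h1 := Lagrange.eq_interpolate (s := Finset.univ) (v := fun l : Fin p => (node p l : ℂ))
      (f := T) (fun a _ b _ h => node_injective p (Complex.ofReal_injective h)) (by simpa using hT)
    rw [Lagrange.interpolate_apply] at h1
    nth_rewrite 1 [h1]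
    rw [Polynomial.eval_finsetSum]
    refine Finset.sum_congr rfl fun i _ => ?_
    rw [Polynomial.eval_mul, Polynomial.eval_C, eval_lagrange_basis]
  have e : ((g t - ∑ i, g (node p i) * lag p i t : ℝ) : ℂ) = ((g t : ℂ) - T.eval (t : ℂ)) -
      ∑ i, ((g (node p i) : ℂ) - T.eval (node p i : ℂ)) * (lag p i t : ℂ) := by
    simp only [sub_mul, Finset.sum_sub_distrib]
    rw [← hrep]
    push_cast
    ring
  rw [← Real.norm_eq_abs, ← Complex.norm_real, e]
  have h2 : ‖∑ i, ((g (node p i) : ℂ) - T.eval (node p i : ℂ)) * (lag p i t : ℂ)‖ ≤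
      ε * Real.exp (4 * p) := by
    refine (norm_sum_le _ _).trans (le_trans ?_
      (mul_le_mul_of_nonneg_left (sum_abs_lag_le p ht) hε0))
    rw [Finset.mul_sum]
    refine Finset.sum_le_sum fun i _ => ?_
    rw [norm_mul, Complex.norm_real, Real.norm_eq_abs]
    exact mul_le_mul_of_nonneg_right (key _ (abs_node_le p i)) (abs_nonneg _)
  have h3 : 1 ≤ Real.exp (4 * p) := Real.one_le_exp (by positivity)
  have h4 := key t ht
  refine (norm_sub_le _ _).trans ?_
  nlinarith

/-! ### Tensor product interpolation. -/

/-- Error of tensor product interpolation, from the errors in the single variables. -/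
lemma abs_sub_tensor_le {p : ℕ} {u : Fin p → ℝ} (hu : ∀ i, |u i| ≤ 1) {ℓ : Fin p → ℝ → ℝ} {Λ ε : ℝ}
    (hΛ : 1 ≤ Λ) (hε : 0 ≤ ε) (hℓ : ∀ t, |t| ≤ 1 → ∑ i, |ℓ i t| ≤ Λ) (d : ℕ) :
    ∀ {g : (Fin d → ℝ) → ℝ}, (∀ x, (∀ k, |x k| ≤ 1) → ∀ j,
        |g x - ∑ i, g (Function.update x j (u i)) * ℓ i (x j)| ≤ ε) →
      ∀ x, (∀ k, |x k| ≤ 1) →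
        |g x - ∑ i : Fin d → Fin p, g (fun j => u (i j)) * ∏ j, ℓ (i j) (x j)| ≤
          d * Λ ^ d * ε := by
  induction d with
  | zero =>
    intro g _ x _
    have e : ∀ i : Fin 0 → Fin p, (fun j => u (i j)) = x := fun i => Subsingleton.elim _ _
    simp [e]
  | succ d ih =>
    intro g hg x hx
    -- The tail variables are interpolated with `x 0` frozen; `h2` then treats variable `0` at the
    -- grid values of the tail.
    have h1 := ih (g := fun y => g (Fin.cons (x 0) y)) (fun y hy j => by
      have hc : ∀ k, |(Fin.cons (x 0) y : Fin (d + 1) → ℝ) k| ≤ 1 :=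
        Fin.cases (by simpa using hx 0) (by simpa using hy)
      have := hg (Fin.cons (x 0) y) hc j.succ
      simpa only [Fin.cons_update, Fin.cons_succ] using this) (Fin.tail x) (fun k => hx k.succ)
    simp only [Fin.cons_self_tail] at h1
    set w : (Fin d → Fin p) → ℝ := fun i => ∏ j, ℓ (i j) (Fin.tail x j) with hw
    have h2 : ∀ i : Fin d → Fin p, |g (Fin.cons (x 0) fun j => u (i j)) -
        ∑ a, g (Fin.cons (u a) fun j => u (i j)) * ℓ a (x 0)| ≤ ε := by
      intro i
      have hc : ∀ k, |(Fin.cons (x 0) (fun j => u (i j)) : Fin (d + 1) → ℝ) k| ≤ 1 :=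
        Fin.cases (by simpa using hx 0) (by simpa using fun k => hu (i k))
      have := hg _ hc 0
      simpa only [Fin.update_cons_zero, Fin.cons_zero] using this
    have h3 : ∑ i, |w i| ≤ Λ ^ d := by
      have : ∑ i, |w i| = ∏ j : Fin d, ∑ a, |ℓ a (Fin.tail x j)| := by
        rw [Finset.prod_univ_sum, Fintype.piFinset_univ]
        exact Finset.sum_congr rfl fun i _ => Finset.abs_prod _ _
      rw [this]
      refine (Finset.prod_le_prod (fun j _ => Finset.sum_nonneg fun _ _ => abs_nonneg _)
        fun j _ => hℓ _ (hx j.succ)).trans ?_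
      simp
    have h4 : ∑ i : Fin (d + 1) → Fin p, g (fun j => u (i j)) * ∏ j, ℓ (i j) (x j) =
        ∑ i, (∑ a, g (Fin.cons (u a) fun j => u (i j)) * ℓ a (x 0)) * w i := by
      rw [← (Fin.consEquiv fun _ => Fin p).sum_comp, Fintype.sum_prod_type_right]
      refine Finset.sum_congr rfl fun i _ => ?_
      rw [Finset.sum_mul]
      refine Finset.sum_congr rfl fun a _ => ?_
      have e : (fun j => u ((Fin.consEquiv fun _ => Fin p) (a, i) j)) =
          (Fin.cons (u a) fun j => u (i j) : Fin (d + 1) → ℝ) := by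
        ext j
        refine Fin.cases ?_ (fun j => ?_) j <;> simp
      rw [e, Fin.prod_univ_succ]
      simp [hw, Fin.tail, mul_assoc]
    have h5 : |∑ i, (g (Fin.cons (x 0) fun j => u (i j)) -
        ∑ a, g (Fin.cons (u a) fun j => u (i j)) * ℓ a (x 0)) * w i| ≤ ε * Λ ^ d := by
      refine (Finset.abs_sum_le_sum_abs _ _).trans (le_trans ?_ (mul_le_mul_of_nonneg_left h3 hε))
      rw [Finset.mul_sum]
      refine Finset.sum_le_sum fun i _ => ?_
      rw [abs_mul]
      exact mul_le_mul_of_nonneg_right (h2 i) (abs_nonneg _)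
    simp only [sub_mul, Finset.sum_sub_distrib] at h5
    rw [h4]
    refine (abs_sub_le _ (∑ i, g (Fin.cons (x 0) fun j => u (i j)) * w i) _).trans
      ((add_le_add h1 h5).trans ?_)
    have h6 : d * Λ ^ d * ε + ε * Λ ^ d = (d + 1) * Λ ^ d * ε := by ring
    rw [h6]
    push_cast
    gcongr
    exact Nat.le_succ d

/-! ### A piecewise linear partition of unity. -/

/-- The piecewise linear function that is `0` on `(-∞, 0]`, `1` on `[1, ∞)`, and the identity
between. -/
noncomputable def ramp (s : ℝ) : ℝ := (|s| - |s - 1| + 1) / 2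

/-- The hat function supported on `[-1, 1]`. -/
noncomputable def hat (s : ℝ) : ℝ := ramp (s + 1) - ramp s

/-- The truncation to `[-1, 1]`. -/
noncomputable def clip (s : ℝ) : ℝ := (|s + 1| - |s - 1|) / 2

lemma ramp_of_nonpos {s : ℝ} (h : s ≤ 0) : ramp s = 0 := by
  rw [ramp, abs_of_nonpos h, abs_of_nonpos (by linarith)]; ring

lemma ramp_of_mem {s : ℝ} (h : 0 ≤ s) (h' : s ≤ 1) : ramp s = s := by
  rw [ramp, abs_of_nonneg h, abs_of_nonpos (by linarith)]; ring

lemma ramp_of_one_le {s : ℝ} (h : 1 ≤ s) : ramp s = 1 := by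
  rw [ramp, abs_of_nonneg (by linarith), abs_of_nonneg (by linarith)]; ring

lemma ramp_mem (s : ℝ) : 0 ≤ ramp s ∧ ramp s ≤ 1 := by
  rcases le_total s 0 with h | h
  · simp [ramp_of_nonpos h]
  · rcases le_total s 1 with h' | h'
    · rw [ramp_of_mem h h']; exact ⟨h, h'⟩
    · simp [ramp_of_one_le h']

lemma hat_nonneg (s : ℝ) : 0 ≤ hat s := by
  unfold hat
  rcases le_total s 0 with h | h
  · rw [ramp_of_nonpos h]; linarith [(ramp_mem (s + 1)).1]
  · rw [ramp_of_one_le (s := s + 1) (by linarith)]; linarith [(ramp_mem s).2]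

lemma hat_le_one (s : ℝ) : hat s ≤ 1 := by
  unfold hat
  linarith [(ramp_mem (s + 1)).2, (ramp_mem s).1]

lemma hat_eq_zero {s : ℝ} (h : 1 < |s|) : hat s = 0 := by
  unfold hat
  rcases lt_abs.1 h with h | h
  · rw [ramp_of_one_le h.le, ramp_of_one_le (by linarith), sub_self]
  · rw [ramp_of_nonpos (by linarith), ramp_of_nonpos (by linarith), sub_self]

lemma sum_hat (M : ℕ) (s : ℝ) :
    ∑ a ∈ Finset.range (2 * M + 1), hat (s - (a - M)) = ramp (s + M + 1) - ramp (s - M) := by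
  have h : ∀ a : ℕ, hat (s - (a - M)) = ramp (s + M + 1 - (a : ℕ)) -
      ramp (s + M + 1 - ((a + 1 : ℕ) : ℝ)) := by
    intro a
    unfold hat
    push_cast
    congr 2 <;> ring
  simp only [h]
  rw [Finset.sum_range_sub' (fun a : ℕ => ramp (s + M + 1 - (a : ℝ)))]
  push_cast
  congr 2 <;> ring

lemma sum_hat_mem (M : ℕ) (s : ℝ) :
    0 ≤ ∑ a ∈ Finset.range (2 * M + 1), hat (s - (a - M)) ∧
      ∑ a ∈ Finset.range (2 * M + 1), hat (s - (a - M)) ≤ 1 := by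
  refine ⟨Finset.sum_nonneg fun a _ => hat_nonneg _, ?_⟩
  rw [sum_hat]
  linarith [(ramp_mem (s + M + 1)).2, (ramp_mem (s - M)).1]

lemma sum_hat_eq_one (M : ℕ) {s : ℝ} (hs : |s| ≤ M) :
    ∑ a ∈ Finset.range (2 * M + 1), hat (s - (a - M)) = 1 := by
  rw [abs_le] at hs
  rw [sum_hat, ramp_of_one_le (by linarith), ramp_of_nonpos (by linarith), sub_zero]

lemma abs_clip_le (s : ℝ) : |clip s| ≤ 1 := by
  have h1 := abs_sub_abs_le_abs_sub (s + 1) (s - 1)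
  have h2 := abs_sub_abs_le_abs_sub (s - 1) (s + 1)
  have e1 : s + 1 - (s - 1) = 2 := by ring
  have e2 : s - 1 - (s + 1) = -2 := by ring
  rw [e1, abs_two] at h1
  rw [e2, abs_neg, abs_two] at h2
  rw [clip, abs_le]
  constructor <;> linarith

lemma clip_of_abs_le {s : ℝ} (h : |s| ≤ 1) : clip s = s := by
  rw [abs_le] at h
  rw [clip, abs_of_nonneg (by linarith), abs_of_nonpos (by linarith)]
  ring

/-! ### The glued local interpolants and their error. -/

/-- The weight against which the pointwise errors are measured. -/
noncomputable def expWeight {d : ℕ} (α : ℝ) (x : Fin d → ℝ) : ℝ :=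
  Real.exp (∑ j, (x j ^ 2 / 4 - α * |x j|))

/-- The interpolation points of the cell with centre `h • a`. -/
noncomputable def cellNode {d p : ℕ} (h : ℝ) (a : Fin d → ℝ) (i : Fin d → Fin p) : Fin d → ℝ :=
  fun j => h * (a j + node p (i j))

section approximation

variable {d : ℕ} {β : Fin d → ℝ} {f : (Fin d → ℝ) → ℝ} {F : (Fin d → ℂ) → ℂ} {b r h : ℝ}

/-- Interpolation error on a single cell. -/
lemma abs_sub_cell_le (hF : DifferentiableOn ℂ F (stripProduct β))
    (hFf : ∀ x : Fin d → ℝ, F (fun j => (x j : ℂ)) = (f x : ℂ)) (hb : 0 ≤ b)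
    (hFb : ∀ z ∈ stripProduct β, ‖F z‖ ≤ b * Real.exp (∑ j, (z j).re ^ 2 / 4))
    (hr : ∀ j, r ≤ β j) (h0 : 0 < h) (hhr : h < r) (p : ℕ) (a x : Fin d → ℝ)
    (hx : ∀ j, |x j / h - a j| ≤ 1) :
    |f x - ∑ i : Fin d → Fin p, f (cellNode h a i) * ∏ j, lag p (i j) (x j / h - a j)| ≤
      d * Real.exp (4 * p) ^ d * (2 * Real.exp (4 * p) *
        (b * Real.exp (∑ j, (|x j| + 2 * r) ^ 2 / 4) * (2 / (r / h)) ^ p)) := by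
  have hr0 : 0 < r := h0.trans hhr
  have key := abs_sub_tensor_le (abs_node_le p) (ℓ := lag p) (Λ := Real.exp (4 * p))
    (ε := 2 * Real.exp (4 * p) *
        (b * Real.exp (∑ j, (|x j| + 2 * r) ^ 2 / 4) * (2 / (r / h)) ^ p))
    (Real.one_le_exp (by positivity)) (by positivity) (fun t ht => sum_abs_lag_le p ht) d
    (g := fun y => f fun j => h * (a j + y j)) ?_ (fun j => x j / h - a j) hx
  · have e : (fun j => h * (a j + (x j / h - a j))) = x := by
      ext j
      field_simp
      ring
    simp only [e] at key
    exact key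
  · intro y hy j
    have hax : ∀ k, |a k * h| ≤ |x k| + h := by
      intro k
      have h1 : a k * h = x k - h * (x k / h - a k) := by field_simp; ring
      rw [h1]
      refine (abs_sub _ _).trans ?_
      rw [abs_mul, abs_of_pos h0]
      have := mul_le_mul_of_nonneg_left (hx k) h0.le
      linarith
    set P : ℂ → Fin d → ℂ := fun z =>
      Function.update (fun k => ((h * (a k + y k) : ℝ) : ℂ)) j (h * (a j + z)) with hP
    have hPmem : ∀ z ∈ Metric.ball (0 : ℂ) (r / h), P z ∈ stripProduct β := by
      intro z hz k
      rw [mem_ball_zero_iff, lt_div_iff₀ h0] at hz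
      by_cases hk : k = j
      · subst hk
        have h1 := Complex.abs_im_le_norm z
        have h2 : (P z k).im = h * z.im := by simp [hP]
        rw [h2, abs_mul, abs_of_pos h0]
        nlinarith [hr k]
      · simp only [hP, Function.update_of_ne hk, Complex.ofReal_im, abs_zero]
        exact hr0.trans_le (hr k)
    -- The cell centre is within `h < r` of `x` in each coordinate, and moving inside the disc or
    -- the cell adds at most `r`.
    have hre : ∀ z ∈ Metric.ball (0 : ℂ) (r / h), ∀ k, |(P z k).re| ≤ |x k| + 2 * r := by
      intro z hz k
      rw [mem_ball_zero_iff, lt_div_iff₀ h0] at hz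
      by_cases hk : k = j
      · subst hk
        have h1 := Complex.abs_re_le_norm z
        have h2 : (P z k).re = a k * h + h * z.re := by simp [hP]; ring
        rw [h2]
        refine (abs_add_le _ _).trans ?_
        rw [abs_mul h, abs_of_pos h0]
        nlinarith [hax k]
      · simp only [hP, Function.update_of_ne hk, Complex.ofReal_re]
        rw [mul_add, mul_comm]
        refine (abs_add_le _ _).trans ?_
        rw [abs_mul h, abs_of_pos h0]
        nlinarith [hax k, hy k]
    have hline := abs_sub_lag_le (ρ := r / h) (M := b * Real.exp (∑ j, (|x j| + 2 * r) ^ 2 / 4))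
      ((one_lt_div h0).2 hhr) p (G := fun z => F (P z))
      (g := fun t => f fun k => h * (a k + Function.update y j t k)) ?_ ?_ ?_ (hy j)
    · simpa only [Function.update_eq_self] using hline
    · refine hF.comp (Differentiable.differentiableOn ?_) hPmem
      rw [differentiable_pi]
      intro k
      by_cases hk : k = j
      · subst hk
        simp only [hP, Function.update_self]
        fun_prop
      · simp only [hP, Function.update_of_ne hk]
        fun_prop
    · intro z hz
      refine (hFb _ (hPmem z hz)).trans ?_
      gcongr b * Real.exp (∑ k, ?_ / 4) with k
      rw [← sq_abs]
      exact pow_le_pow_left₀ (abs_nonneg _) (hre z hz k) 2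
    · intro t _
      rw [← hFf]
      congr 1
      ext k
      by_cases hk : k = j
      · subst hk
        simp [hP]
      · simp [hP, Function.update_of_ne hk]

/-- The centres (divided by the mesh size) of the cells. -/
noncomputable def cell {d M : ℕ} (a : Fin d → Fin (2 * M + 1)) : Fin d → ℝ :=
  fun j => ((a j : ℕ) : ℝ) - M

lemma prod_sum_hat (M : ℕ) (x : Fin d → ℝ) :
    ∑ a : Fin d → Fin (2 * M + 1), ∏ j, hat (x j / h - cell a j) =
      ∏ j, ∑ a ∈ Finset.range (2 * M + 1), hat (x j / h - (a - M)) := by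
  simp only [← Fin.sum_univ_eq_sum_range (fun a : ℕ => hat (_ / h - ((a : ℝ) - M)))]
  rw [Finset.prod_univ_sum, Fintype.piFinset_univ]
  rfl

/-- The piecewise polynomial approximation of `f`, cut off to zero away from the origin. -/
noncomputable def cellApprox (f : (Fin d → ℝ) → ℝ) (h : ℝ) (M p : ℕ) (x : Fin d → ℝ) : ℝ :=
  ∑ a : Fin d → Fin (2 * M + 1), ∑ i : Fin d → Fin p, f (cellNode h (cell a) i) *
    ∏ j, (hat (x j / h - cell a j) * lag p (i j) (clip (x j / h - cell a j)))

lemma abs_cell_le {M : ℕ} (a : Fin d → Fin (2 * M + 1)) (j : Fin d) : |cell a j| ≤ M := by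
  have h : ((a j : ℕ) : ℝ) ≤ 2 * M := by exact_mod_cast Nat.lt_succ_iff.1 (a j).2
  have h' : (0 : ℝ) ≤ ((a j : ℕ) : ℝ) := by positivity
  rw [cell, abs_le]
  constructor <;> linarith

/-- Compare with `χ f`, where `χ` is the sum of all hat products and equals `1` on the box of
half-width `M h`. The tail `f - χ f` uses the decay of `f`; `χ f - cellApprox` is a combination of
cell errors with nonnegative weights summing to at most `1`. Since `(|x| + 2 r) ^ 2 / 4 = x ^ 2 / 4
+ r |x| + r ^ 2`, each coordinate costs `(r + α) |x| + r ^ 2` relative to the weight. -/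
lemma abs_sub_cellApprox_le (hF : DifferentiableOn ℂ F (stripProduct β))
    (hFf : ∀ x : Fin d → ℝ, F (fun j => (x j : ℂ)) = (f x : ℂ)) (hb : 0 ≤ b)
    (hFb : ∀ z ∈ stripProduct β, ‖F z‖ ≤ b * Real.exp (∑ j, (z j).re ^ 2 / 4))
    {α : ℝ} (hα : 0 ≤ α) (hfb : ∀ x, |f x| ≤ b * expWeight (2 * α) x)
    (hr : ∀ j, r ≤ β j) (h0 : 0 < h) (hhr : h < r) (M p : ℕ) (x : Fin d → ℝ) :
    |f x - cellApprox f h M p x| ≤ (b * Real.exp (-(α * (M * h))) +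
      d * Real.exp (4 * p) ^ d * (2 * Real.exp (4 * p) * (b *
        Real.exp (d * ((r + α) * ((M + 1) * h) + r ^ 2)) * (2 / (r / h)) ^ p))) *
          expWeight α x := by
  have hr0 : 0 < r := h0.trans hhr
  set χ : ℝ := ∏ j, ∑ a ∈ Finset.range (2 * M + 1), hat (x j / h - (a - M)) with hχ
  have hχ0 : 0 ≤ χ := Finset.prod_nonneg fun j _ => (sum_hat_mem M _).1
  have hχ1 : χ ≤ 1 := Finset.prod_le_one (fun j _ => (sum_hat_mem M _).1)
    fun j _ => (sum_hat_mem M _).2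
  have h1 : |f x - χ * f x| ≤ b * Real.exp (-(α * (M * h))) * expWeight α x := by
    by_cases hx : ∀ j, |x j / h| ≤ M
    · rw [hχ, Finset.prod_eq_one fun j _ => sum_hat_eq_one M (hx j), one_mul, sub_self, abs_zero]
      unfold expWeight
      positivity
    · push Not at hx
      obtain ⟨k, hk⟩ := hx
      rw [abs_div, abs_of_pos h0, lt_div_iff₀ h0] at hk
      have e : f x - χ * f x = (1 - χ) * f x := by ring
      rw [e, abs_mul, abs_of_nonneg (by linarith)]
      refine (mul_le_of_le_one_left (abs_nonneg _) (by linarith)).trans ((hfb x).trans ?_)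
      rw [mul_assoc]
      refine mul_le_mul_of_nonneg_left ?_ hb
      unfold expWeight
      rw [← Real.exp_add]
      refine Real.exp_le_exp.2 ?_
      have h2 : |x k| ≤ ∑ j, |x j| :=
        Finset.single_le_sum (f := fun j => |x j|) (fun j _ => abs_nonneg _) (Finset.mem_univ k)
      simp only [Finset.sum_sub_distrib, ← Finset.mul_sum]
      nlinarith
  have h2 : |χ * f x - cellApprox f h M p x| ≤ d * Real.exp (4 * p) ^ d * (2 * Real.exp (4 * p) *
      (b * Real.exp (d * ((r + α) * ((M + 1) * h) + r ^ 2)) * (2 / (r / h)) ^ p)) *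
        expWeight α x := by
    set E := d * Real.exp (4 * p) ^ d * (2 * Real.exp (4 * p) *
      (b * Real.exp (d * ((r + α) * ((M + 1) * h) + r ^ 2)) * (2 / (r / h)) ^ p)) *
        expWeight α x with hE
    have hE0 : 0 ≤ E := by
      rw [hE]
      unfold expWeight
      positivity
    have e : χ * f x - cellApprox f h M p x = ∑ a : Fin d → Fin (2 * M + 1),
        (∏ j, hat (x j / h - cell a j)) * (f x - ∑ i : Fin d → Fin p,
          f (cellNode h (cell a) i) * ∏ j, lag p (i j) (clip (x j / h - cell a j))) := by
      rw [hχ, ← prod_sum_hat, cellApprox, Finset.sum_mul, ← Finset.sum_sub_distrib]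
      refine Finset.sum_congr rfl fun a _ => ?_
      rw [mul_sub, Finset.mul_sum]
      congr 1
      refine Finset.sum_congr rfl fun i _ => ?_
      rw [Finset.prod_mul_distrib]
      ring
    rw [e]
    refine (Finset.abs_sum_le_sum_abs _ _).trans ?_
    have h3 : ∀ a : Fin d → Fin (2 * M + 1), |(∏ j, hat (x j / h - cell a j)) *
        (f x - ∑ i : Fin d → Fin p, f (cellNode h (cell a) i) *
          ∏ j, lag p (i j) (clip (x j / h - cell a j)))| ≤
        (∏ j, hat (x j / h - cell a j)) * E := by
      intro a
      rw [abs_mul, abs_of_nonneg (Finset.prod_nonneg fun j _ => hat_nonneg _)]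
      by_cases hx : ∀ j, |x j / h - cell a j| ≤ 1
      · refine mul_le_mul_of_nonneg_left ?_ (Finset.prod_nonneg fun j _ => hat_nonneg _)
        simp only [fun j => clip_of_abs_le (hx j)]
        refine (abs_sub_cell_le hF hFf hb hFb hr h0 hhr p (cell a) x hx).trans ?_
        have h4 : Real.exp (∑ j, (|x j| + 2 * r) ^ 2 / 4) ≤
            Real.exp (d * ((r + α) * ((M + 1) * h) + r ^ 2)) * expWeight α x := by
          unfold expWeight
          rw [← Real.exp_add]
          refine Real.exp_le_exp.2 ?_
          have h5 : (d : ℝ) * ((r + α) * ((M + 1) * h) + r ^ 2) =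
              ∑ _j : Fin d, ((r + α) * ((M + 1) * h) + r ^ 2) := by
            simp only [Finset.sum_const, Finset.card_univ, Fintype.card_fin, nsmul_eq_mul]
          rw [h5, ← Finset.sum_add_distrib]
          refine Finset.sum_le_sum fun j _ => ?_
          have h6 : |x j| ≤ (M + 1) * h := by
            have h6' : |x j| / h = |x j / h| := by rw [abs_div, abs_of_pos h0]
            rw [← div_le_iff₀ h0, h6']
            have := abs_sub_abs_le_abs_sub (x j / h) (cell a j)
            linarith [hx j, abs_cell_le a j]
          have h7 : |x j| ^ 2 = x j ^ 2 := sq_abs _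
          have h8 := mul_le_mul_of_nonneg_left h6 (by positivity : 0 ≤ r + α)
          linarith
        rw [hE]
        calc _ ≤ d * Real.exp (4 * p) ^ d * (2 * Real.exp (4 * p) * (b *
              (Real.exp (d * ((r + α) * ((M + 1) * h) + r ^ 2)) * expWeight α x) *
              (2 / (r / h)) ^ p)) := by gcongr
          _ = _ := by ring
      · push Not at hx
        obtain ⟨k, hk⟩ := hx
        rw [Finset.prod_eq_zero (Finset.mem_univ k) (hat_eq_zero hk), zero_mul, zero_mul]
    refine (Finset.sum_le_sum fun a _ => h3 a).trans ?_
    rw [← Finset.sum_mul, prod_sum_hat]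
    exact mul_le_of_le_one_left hE0 hχ1
  refine (abs_sub_le _ (χ * f x) _).trans ((add_le_add h1 h2).trans (le_of_eq ?_))
  ring

/-! ### Realizing the glued interpolant by a network. -/

/-- The factors of a single term of `cellApprox`. -/
noncomputable def cellFactor {p : ℕ} (h : ℝ) (a : Fin d → ℝ) (i : Fin d → Fin p)
    (q : Fin d × Fin p) (x : Fin d → ℝ) : ℝ :=
  if q.2 = i q.1 then hat (x q.1 / h - a q.1) else (clip (x q.1 / h - a q.1) - node p q.2) / 2

lemma isFactor_cellFactor {p : ℕ} (h : ℝ) (a : Fin d → ℝ) (i : Fin d → Fin p)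
    (q : Fin d × Fin p) : IsFactor (cellFactor h a i q) := by
  unfold cellFactor
  split_ifs
  · refine ⟨q.1, 1 / h, 0, ![1 - a q.1, -a q.1, -1 - a q.1], ![1 / 2, -1, 1 / 2], fun x => ?_⟩
    simp only [Fin.sum_univ_three, Matrix.cons_val, hat, ramp]
    ring_nf
  · refine ⟨q.1, 1 / h, -node p q.2 / 2, ![1 - a q.1, -a q.1, -1 - a q.1],
      ![1 / 4, 0, -1 / 4], fun x => ?_⟩
    simp only [Fin.sum_univ_three, Matrix.cons_val, clip]
    ring_nf

/-- Here `clip` matters: without it the bound would fail away from the cell, and the multiplication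
estimates would not hold on all of `ℝ ^ d`. -/
lemma abs_cellFactor_le {p : ℕ} (h : ℝ) (a : Fin d → ℝ) (i : Fin d → Fin p)
    (q : Fin d × Fin p) (x : Fin d → ℝ) : |cellFactor h a i q x| ≤ 1 := by
  unfold cellFactor
  split_ifs
  · rw [abs_of_nonneg (hat_nonneg _)]
    exact hat_le_one _
  · rw [abs_div, abs_two, div_le_one two_pos]
    linarith [abs_sub (clip (x q.1 / h - a q.1)) (node p q.2), abs_node_le p q.2,
      abs_clip_le (x q.1 / h - a q.1)]

/-- In coordinate `j` the Lagrange polynomial has no factor for the index `i j`; the hat takes that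
place. Every term then has exactly `d p` factors, so all the networks summed have equal depth. -/
lemma prod_cellFactor {p : ℕ} (h : ℝ) (a : Fin d → ℝ) (i : Fin d → Fin p) (x : Fin d → ℝ) :
    (∏ j, lagWeight p (i j)) * ∏ q, cellFactor h a i q x =
      ∏ j, (hat (x j / h - a j) * lag p (i j) (clip (x j / h - a j))) := by
  rw [Fintype.prod_prod_type, ← Finset.prod_mul_distrib]
  refine Finset.prod_congr rfl fun j _ => ?_
  rw [← Finset.mul_prod_erase _ _ (Finset.mem_univ (i j)), lag, cellFactor, if_pos rfl,
    mul_left_comm]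
  congr 2
  refine Finset.prod_congr rfl fun l hl => ?_
  rw [cellFactor, if_neg (Finset.ne_of_mem_erase hl)]

/-- The piecewise polynomial approximation is realized approximately by a ReLU network. -/
lemma exists_feedForward_cellApprox {A : ℝ} (h : ℝ) (M p n : ℕ)
    (hA : ∀ (a : Fin d → Fin (2 * M + 1)) (i : Fin d → Fin p), |f (cellNode h (cell a) i)| ≤ A)
    (hA0 : 0 ≤ A) :
    ∃ Φ : FeedForward 1 d, Φ.depth = d * p * (n + 2) ∧
      Φ.size ≤ (2 * M + 1) ^ d * p ^ d * ((d * p * (n + 2) + 1) *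
        ((2 * d + 8) * (2 * d + 8) + (2 * d + 8))) ∧
      ∀ x, |cellApprox f h M p x - Φ.realize relu x 0| ≤
        (2 * M + 1) ^ d * (A * Real.exp (4 * p) ^ d * (d * p * (1 / 4) ^ n)) := by
  set l : (Fin d → Fin (2 * M + 1)) × (Fin d → Fin p) → List ((Fin d → ℝ) → ℝ) := fun k =>
    (Finset.univ : Finset (Fin d × Fin p)).toList.map (cellFactor h (cell k.1) k.2) with hl
  set c : (Fin d → Fin (2 * M + 1)) × (Fin d → Fin p) → ℝ := fun k =>
    f (cellNode h (cell k.1) k.2) * ∏ j, lagWeight p (k.2 j) with hc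
  have hlen : ∀ k, (l k).length = d * p := fun k => by simp [hl]
  obtain ⟨Φ, h1, h2, h3⟩ := FeedForward.exists_sum relu
    (Finset.univ : Finset ((Fin d → Fin (2 * M + 1)) × (Fin d → Fin p)))
    (g := fun k x _ => c k * approxProd n (l k) x 1) (n := 1) (L := d * p * (n + 2))
    (s := (d * p * (n + 2) + 1) * ((2 * d + 8) * (2 * d + 8) + (2 * d + 8))) (by
      intro k _
      have := exists_feedForward_approxProd n (c k) (l k) (by
        intro v hv
        obtain ⟨q, _, rfl⟩ := List.mem_map.1 hv
        exact isFactor_cellFactor _ _ _ _)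
      rwa [hlen] at this)
  refine ⟨Φ, h1, ?_, fun x => ?_⟩
  · refine h2.trans (le_of_eq ?_)
    rw [Finset.card_univ, Fintype.card_prod, Fintype.card_fun, Fintype.card_fun, Fintype.card_fin,
      Fintype.card_fin, Fintype.card_fin]
  · have e : cellApprox f h M p x = ∑ k, c k * (1 * ((l k).map fun v => v x).prod) := by
      rw [cellApprox, Fintype.sum_prod_type]
      refine Finset.sum_congr rfl fun a _ => Finset.sum_congr rfl fun i _ => ?_
      rw [← prod_cellFactor, hc, hl]
      simp only [List.map_map, one_mul]
      rw [mul_assoc, ← Finset.prod_map_toList Finset.univ fun q => cellFactor h (cell a) i q x]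
      rfl
    rw [h3, Finset.sum_apply, e, ← Finset.sum_sub_distrib]
    refine (Finset.abs_sum_le_sum_abs _ _).trans ?_
    have h4 : ∀ k, |c k * (1 * ((l k).map fun v => v x).prod) - c k * approxProd n (l k) x 1| ≤
        A * (∏ j, |lagWeight p (k.2 j)|) * (d * p * (1 / 4) ^ n) := by
      intro k
      rw [← mul_sub, abs_mul, abs_sub_comm]
      have h5 := approxProd_sub_le n (l k) x (by
        intro v hv
        obtain ⟨q, _, rfl⟩ := List.mem_map.1 hv
        exact abs_cellFactor_le _ _ _ _ _) (y := 1) (y' := 1) (by simp)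
      rw [hlen, sub_self, abs_zero, zero_add] at h5
      push_cast at h5
      refine mul_le_mul ?_ h5 (abs_nonneg _) (by positivity)
      rw [hc, abs_mul, Finset.abs_prod]
      exact mul_le_mul_of_nonneg_right (hA _ _) (by positivity)
    refine (Finset.sum_le_sum fun k _ => h4 k).trans ?_
    rw [← Finset.sum_mul, ← Finset.mul_sum, Fintype.sum_prod_type]
    have h6 : ∑ i : Fin d → Fin p, ∏ j, |lagWeight p (i j)| ≤ Real.exp (4 * p) ^ d := by
      have : ∑ i : Fin d → Fin p, ∏ j, |lagWeight p (i j)| =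
          ∏ _j : Fin d, ∑ a, |lagWeight p a| := by
        rw [Finset.prod_univ_sum, Fintype.piFinset_univ]
      rw [this, Finset.prod_const, Finset.card_univ, Fintype.card_fin]
      exact pow_le_pow_left₀ (Finset.sum_nonneg fun _ _ => abs_nonneg _) (sum_abs_lagWeight_le p) d
    simp only [Finset.sum_const, Finset.card_univ, Fintype.card_fun, Fintype.card_fin, nsmul_eq_mul]
    push_cast
    calc A * ((2 * M + 1) ^ d * ∑ i : Fin d → Fin p, ∏ j, |lagWeight p (i j)|) *
          (d * p * (1 / 4) ^ n)
        ≤ A * ((2 * M + 1) ^ d * Real.exp (4 * p) ^ d) * (d * p * (1 / 4) ^ n) := by gcongr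
      _ = _ := by ring

end approximation

/-! ### The error weight and the Gaussian measure. -/

lemma integrable_exp_neg_mul_abs {c : ℝ} (hc : 0 < c) :
    Integrable fun x : ℝ => Real.exp (-c * |x|) := by
  have h1 : IntegrableOn (fun x : ℝ => Real.exp (-c * |x|)) (Set.Ioi 0) :=
    (exp_neg_integrableOn_Ioi 0 hc).congr_fun
      (fun x hx => by simp only [abs_of_pos (Set.mem_Ioi.1 hx)]) measurableSet_Ioi
  have h2 : IntegrableOn (fun x : ℝ => Real.exp (-c * |x|)) (Set.Iic 0) :=
    (integrableOn_exp_mul_Iic hc 0).congr_fun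
      (fun x hx => by simp only [abs_of_nonpos (Set.mem_Iic.1 hx)]; ring_nf) measurableSet_Iic
  rw [← integrableOn_univ, ← Set.Iic_union_Ioi (a := (0 : ℝ))]
  exact h2.union h1

/-- The squared factor `exp (x ^ 2 / 2)` cancels the Gaussian density and leaves a multiple of `exp
(-2 α |x|)`. -/
lemma integrable_exp_gaussianReal {α : ℝ} (hα : 0 < α) :
    Integrable (fun x : ℝ => Real.exp (x ^ 2 / 4 - α * |x|) ^ 2) (gaussianReal 0 1) := by
  rw [gaussianReal_of_var_ne_zero _ one_ne_zero,
    integrable_withDensity_iff_integrable_smul' (measurable_gaussianPDF 0 1)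
      (ae_of_all _ fun _ => gaussianPDF_lt_top)]
  refine ((integrable_exp_neg_mul_abs (c := 2 * α) (by positivity)).const_mul
    (√(2 * Real.pi))⁻¹).congr (ae_of_all _ fun x => ?_)
  simp only [toReal_gaussianPDF, smul_eq_mul, gaussianPDFReal, NNReal.coe_one, mul_one, sub_zero]
  rw [← Real.exp_nat_mul, mul_assoc, ← Real.exp_add]
  congr 2
  push_cast
  ring

lemma eLpNorm_expWeight_lt_top {α : ℝ} (hα : 0 < α) (d : ℕ) :
    eLpNorm (expWeight α) 2 (stdGaussianMeasure d) < ⊤ := by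
  have hm : Continuous (expWeight (d := d) α) := by
    unfold expWeight
    fun_prop
  refine MemLp.eLpNorm_lt_top ((memLp_two_iff_integrable_sq hm.aestronglyMeasurable).2 ?_)
  have h := Integrable.fintype_prod (ι := Fin d) (μ := fun _ => gaussianReal 0 1)
    (f := fun _ x => Real.exp (x ^ 2 / 4 - α * |x|) ^ 2) fun _ => integrable_exp_gaussianReal hα
  refine h.congr (ae_of_all _ fun x => ?_)
  simp only [expWeight, Real.exp_sum, Finset.prod_pow]

/-- Completing the square; this turns the uniform error of the network into a weighted one. -/
lemma one_le_exp_mul_expWeight {d : ℕ} (α : ℝ) (x : Fin d → ℝ) :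
    1 ≤ Real.exp (d * α ^ 2) * expWeight α x := by
  unfold expWeight
  rw [← Real.exp_add]
  refine Real.one_le_exp ?_
  have h : (d : ℝ) * α ^ 2 = ∑ _j : Fin d, α ^ 2 := by
    simp only [Finset.sum_const, Finset.card_univ, Fintype.card_fin, nsmul_eq_mul]
  rw [h, ← Finset.sum_add_distrib]
  refine Finset.sum_nonneg fun j _ => ?_
  nlinarith [sq_abs (x j), sq_nonneg (|x j| / 2 - α)]

/-! ### Choice of parameters and conclusion. -/

lemma half_le_two_rpow : (1 / 2 : ℝ) ≤ (2 : ℝ) ^ (-(1 / 2) : ℝ) := by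
  have : (1 / 2 : ℝ) = (2 : ℝ) ^ (-1 : ℝ) := by
    rw [Real.rpow_neg_one]; norm_num
  rw [this]
  exact Real.rpow_le_rpow_of_exponent_le one_le_two (by norm_num)

/-- The error of the networks is small if the multiplications are accurate enough. -/
lemma network_error_le {d M p n : ℕ} {b κ h c₁ c₂ c₃ S : ℝ} (hb : 0 ≤ b) (hκ : 0 ≤ κ) (h0 : 0 < h)
    (hc₁ : 0 ≤ c₁) (hc₂ : 0 ≤ c₂)
    (hc₃ : c₃ = d * (2 * c₁) + d * ((h * (c₁ + 1)) ^ 2 / 4) + 5 * d * (c₂ + 1))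
    (hS : 1 ≤ S) (hM : (M : ℝ) + 1 ≤ (c₁ + 1) * S) (hM1 : (M : ℝ) ≤ c₁ * S)
    (hp : (p : ℝ) ≤ (c₂ + 1) * S)
    (hn : (c₃ + κ) * S ^ 2 ≤ n) :
    (2 * (M : ℝ) + 1) ^ d * (b * Real.exp (d * ((h * (M + 1)) ^ 2 / 4)) *
      Real.exp (4 * p) ^ d * (d * p * (1 / 4) ^ n)) ≤ b * Real.exp (-(κ * S)) := by
  have hSS : S ≤ S ^ 2 := by nlinarith
  have hS0 : 0 < S := by linarith
  have e1 : (2 * (M : ℝ) + 1) ^ d ≤ Real.exp (d * (2 * (c₁ * S))) := by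
    rw [Real.exp_nat_mul]
    refine pow_le_pow_left₀ (by positivity) ((Real.add_one_le_exp _).trans ?_) d
    exact Real.exp_le_exp.2 (by linarith)
  have e2 : Real.exp (d * ((h * (M + 1)) ^ 2 / 4)) ≤
      Real.exp (d * ((h * ((c₁ + 1) * S)) ^ 2 / 4)) := by gcongr
  have e3 : Real.exp (4 * p) ^ d ≤ Real.exp (d * (4 * ((c₂ + 1) * S))) := by
    rw [Real.exp_nat_mul]
    gcongr
  have e4 : (d : ℝ) * p ≤ Real.exp (d * ((c₂ + 1) * S)) := by
    have := Real.add_one_le_exp ((d : ℝ) * ((c₂ + 1) * S))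
    have h5 : (d : ℝ) * p ≤ d * ((c₂ + 1) * S) := by gcongr
    linarith
  have e5 : (1 / 4 : ℝ) ^ n ≤ Real.exp (-((c₃ + κ) * S ^ 2)) := by
    have h5 : (1 / 4 : ℝ) ≤ Real.exp (-1) := by
      rw [Real.exp_neg, one_div]
      exact inv_anti₀ (Real.exp_pos 1) (by linarith [Real.exp_one_lt_d9])
    refine (pow_le_pow_left₀ (by norm_num) h5 n).trans ?_
    rw [← Real.exp_nat_mul]
    exact Real.exp_le_exp.2 (by linarith)
  calc (2 * (M : ℝ) + 1) ^ d * (b * Real.exp (d * ((h * (M + 1)) ^ 2 / 4)) *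
        Real.exp (4 * p) ^ d * (d * p * (1 / 4) ^ n))
      ≤ Real.exp (d * (2 * (c₁ * S))) * (b * Real.exp (d * ((h * ((c₁ + 1) * S)) ^ 2 / 4)) *
        Real.exp (d * (4 * ((c₂ + 1) * S))) * (Real.exp (d * ((c₂ + 1) * S)) *
          Real.exp (-((c₃ + κ) * S ^ 2)))) := by gcongr
    _ = b * (Real.exp (d * (2 * (c₁ * S))) * Real.exp (d * ((h * ((c₁ + 1) * S)) ^ 2 / 4)) *
        Real.exp (d * (4 * ((c₂ + 1) * S))) * Real.exp (d * ((c₂ + 1) * S)) *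
          Real.exp (-((c₃ + κ) * S ^ 2))) := by ring
    _ ≤ b * Real.exp (-(κ * S)) := by
      refine mul_le_mul_of_nonneg_left ?_ hb
      simp only [← Real.exp_add]
      refine Real.exp_le_exp.2 ?_
      have q1 : d * (2 * (c₁ * S)) ≤ d * (2 * c₁) * S ^ 2 := by
        have := mul_le_mul_of_nonneg_left hSS (by positivity : 0 ≤ d * (2 * c₁))
        linarith
      have q2 : d * ((c₂ + 1) * S) ≤ d * (c₂ + 1) * S ^ 2 := by
        have := mul_le_mul_of_nonneg_left hSS (by positivity : 0 ≤ d * (c₂ + 1))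
        linarith
      have q3 : κ * S ≤ κ * S ^ 2 := mul_le_mul_of_nonneg_left hSS hκ
      -- The summands of `c₃` pay for the number of cells, the size of the samples of `f`, and (as
      -- `4 + 1`) the Lagrange weights and the number of factors.
      have q4 : c₃ * S ^ 2 = d * (2 * c₁) * S ^ 2 + d * ((h * ((c₁ + 1) * S)) ^ 2 / 4) +
          5 * (d * (c₂ + 1) * S ^ 2) := by rw [hc₃]; ring
      linarith

/-- The interpolation error is small if the degree is large enough. -/
lemma interpolation_error_le {d M p : ℕ} {κ h r α c₁ c₂ S : ℝ} (hr : 0 < r) (hα : 0 < α)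
    (h0 : 0 < h) (hh : h = r / 2 * Real.exp (-(4 * d + 5)))
    (hc₂ : c₂ = κ + d * ((r + α) * ((c₁ + 1) * h) + r ^ 2))
    (hS : 1 ≤ S) (hM : (M : ℝ) + 1 ≤ (c₁ + 1) * S) (hp : c₂ * S ≤ p) :
    Real.exp (4 * p) ^ d * (Real.exp (4 * p) *
      (Real.exp (d * ((r + α) * ((M + 1) * h) + r ^ 2)) * (2 / (r / h)) ^ p)) ≤
        Real.exp (-(κ * S)) := by
  -- Against the amplification `exp (4 (d + 1) p)` this leaves `exp (-p)`, and `p ≥ c₂ S` covers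
  -- both the growth on the box and the rate `κ`.
  have e1 : 2 / (r / h) = Real.exp (-(4 * d + 5)) := by
    rw [hh]; field_simp
  rw [e1, ← Real.exp_nat_mul, ← Real.exp_nat_mul, ← Real.exp_add, ← Real.exp_add,
    ← Real.exp_add]
  refine Real.exp_le_exp.2 ?_
  have h4 : (d : ℝ) * ((r + α) * ((M + 1) * h) + r ^ 2) ≤
      d * ((r + α) * ((c₁ + 1) * h) + r ^ 2) * S := by
    calc (d : ℝ) * ((r + α) * ((M + 1) * h) + r ^ 2)
        ≤ d * ((r + α) * (((c₁ + 1) * S) * h) + r ^ 2 * S) := by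
          gcongr
          exact le_mul_of_one_le_right (by positivity) hS
      _ = _ := by ring
  have h5 : c₂ * S = κ * S + d * ((r + α) * ((c₁ + 1) * h) + r ^ 2) * S := by
    rw [hc₂]; ring
  linarith

/-- Pointwise approximation by networks, at any prescribed exponential rate. -/
lemma exists_feedForward_abs_sub_le {d : ℕ} (hd : 0 < d) {β : Fin d → ℝ} (hβ : ∀ j, 0 < β j)
    {b κ : ℝ} (hb : 0 < b) (hκ : 0 ≤ κ) :
    ∃ α : ℝ, 0 < α ∧ ∃ C : ℝ, 0 < C ∧
      ∀ (τ : Fin d → ℝ) (B : (Fin d → ℝ) → ℝ) (f : (Fin d → ℝ) → ℝ),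
        AnalyticWithGrowth τ B f → (∀ j, β j < τ j) → B β = b → ∀ S : ℝ, 1 ≤ S →
          ∃ Φ : FeedForward 1 d, (Φ.size : ℝ) ≤ C * S ^ (2 * d + 3) ∧
            (Φ.depth : ℝ) ≤ C * S ^ 3 ∧
            ∀ x, |f x - Φ.realize relu x 0| ≤ C * Real.exp (-(κ * S)) * expWeight α x := by
  have : Nonempty (Fin d) := ⟨⟨0, hd⟩⟩
  obtain ⟨j₀, hj₀⟩ := Finite.exists_min β
  set r := β j₀ with hr
  have hr0 : 0 < r := hβ j₀
  -- Chosen so that `2 α = r / 2 ≤ 2 ^ (-1 / 2) * β j` for all `j`.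
  set α := r / 4 with hα
  have hα0 : 0 < α := by positivity
  set h := r / 2 * Real.exp (-(4 * d + 5)) with hh
  have h0 : 0 < h := by positivity
  have hhr : h < r := by
    have h1 : Real.exp (-(4 * d + 5)) ≤ 1 := Real.exp_le_one_iff.2 (by
      have : (0 : ℝ) ≤ d := by positivity
      linarith)
    nlinarith
  -- The `+ 1` absorbs the rounding up in `M`, because `S ≥ 1`.
  set c₁ := κ / (α * h) + 1 with hc₁
  have hc₁0 : 0 ≤ c₁ := by positivity
  set c₂ := κ + d * ((r + α) * ((c₁ + 1) * h) + r ^ 2) with hc₂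
  have hc₂0 : 0 ≤ c₂ := by positivity
  set c₃ := d * (2 * c₁) + d * ((h * (c₁ + 1)) ^ 2 / 4) + 5 * d * (c₂ + 1) with hc₃
  have hc₃0 : 0 ≤ c₃ := by positivity
  set c₄ := d * (c₂ + 1) * (c₃ + κ + 3) with hc₄
  have hc₄0 : 0 ≤ c₄ := by positivity
  set c₅ := (2 * c₁ + 1) ^ d * (c₂ + 1) ^ d * ((c₄ + 1) *
    ((2 * d + 8) * (2 * d + 8) + (2 * d + 8))) with hc₅
  have hc₅0 : 0 ≤ c₅ := by positivity
  set c₆ := b + 2 * d * b + b * Real.exp (d * α ^ 2) with hc₆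
  have hc₆0 : 0 < c₆ := by positivity
  clear_value r α h c₁ c₂ c₃ c₄ c₅ c₆
  refine ⟨α, hα0, c₄ + c₅ + c₆, by positivity, ?_⟩
  rintro τ B f ⟨-, F, hF, hFf, hB⟩ hβτ rfl S hS
  have hS0 : 0 < S := by linarith
  obtain ⟨-, hFB⟩ := hB β (fun j => (hβ j).le) fun j => (hβτ j).le
  have hFβ : DifferentiableOn ℂ F (stripProduct β) :=
    hF.mono fun z hz j => (hz j).trans (hβτ j)
  have hFb : ∀ z ∈ stripProduct β, ‖F z‖ ≤ B β * Real.exp (∑ j, (z j).re ^ 2 / 4) := by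
    intro z hz
    refine (hFB z hz).trans (mul_le_mul_of_nonneg_left (Real.exp_le_exp.2 ?_) hb.le)
    refine Finset.sum_le_sum fun j _ => sub_le_self _ ?_
    positivity
  have hfb : ∀ x, |f x| ≤ B β * expWeight (2 * α) x := by
    intro x
    have h1 := hFB (fun j => (x j : ℂ)) fun j => by simpa using hβ j
    rw [hFf, Complex.norm_real, Real.norm_eq_abs] at h1
    refine h1.trans (mul_le_mul_of_nonneg_left (Real.exp_le_exp.2 ?_) hb.le)
    refine Finset.sum_le_sum fun j _ => ?_
    simp only [Complex.ofReal_re, Complex.ofReal_im]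
    rw [zero_pow two_ne_zero, zero_div, sub_zero, Real.sqrt_sq (hβ j).le]
    refine sub_le_sub_left ?_ _
    have h2 : 2 * α ≤ (2 : ℝ) ^ (-(1 / 2) : ℝ) * β j := by
      have := mul_le_mul half_le_two_rpow (hj₀ j) hr0.le (by positivity)
      linarith
    calc 2 * α * |x j| ≤ (2 : ℝ) ^ (-(1 / 2) : ℝ) * β j * |x j| := by gcongr
      _ = _ := by ring
  set M := ⌈κ * S / (α * h)⌉₊ with hM
  have hM1 : (M : ℝ) ≤ c₁ * S := by
    have := (Nat.ceil_lt_add_one (by positivity : 0 ≤ κ * S / (α * h))).le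
    have e : c₁ * S = κ * S / (α * h) + S := by rw [hc₁]; ring
    linarith
  have hM2 : κ * S ≤ α * (M * h) := by
    have := Nat.le_ceil (κ * S / (α * h))
    rw [div_le_iff₀ (by positivity)] at this
    linarith
  set p := ⌈c₂ * S⌉₊ with hp
  have hp1 : (p : ℝ) ≤ (c₂ + 1) * S := by
    have := (Nat.ceil_lt_add_one (by positivity : 0 ≤ c₂ * S)).le
    linarith
  have hp2 : c₂ * S ≤ p := Nat.le_ceil _
  -- Quadratic in `S`, since the bound for the samples of `f` on the box grows like `exp (O(S ^
  -- 2))`.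
  set n := ⌈(c₃ + κ) * S ^ 2⌉₊ with hn
  have hS2 : 1 ≤ S ^ 2 := one_le_pow₀ hS
  have hn1 : (n : ℝ) ≤ (c₃ + κ + 1) * S ^ 2 := by
    have := (Nat.ceil_lt_add_one (by positivity : 0 ≤ (c₃ + κ) * S ^ 2)).le
    linarith
  have hn2 : (c₃ + κ) * S ^ 2 ≤ n := Nat.le_ceil _
  have hMS : (M : ℝ) + 1 ≤ (c₁ + 1) * S := by linarith
  have hA : ∀ (a : Fin d → Fin (2 * M + 1)) (i : Fin d → Fin p), |f (cellNode h (cell a) i)| ≤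
      B β * Real.exp (d * ((h * (M + 1)) ^ 2 / 4)) := by
    intro a i
    refine (hfb _).trans (mul_le_mul_of_nonneg_left (Real.exp_le_exp.2 ?_) hb.le)
    have h1 : (d : ℝ) * ((h * (M + 1)) ^ 2 / 4) = ∑ _j : Fin d, (h * (M + 1)) ^ 2 / 4 := by
      simp only [Finset.sum_const, Finset.card_univ, Fintype.card_fin, nsmul_eq_mul]
    rw [h1]
    refine Finset.sum_le_sum fun j _ => (sub_le_self _ (by positivity)).trans ?_
    rw [← sq_abs, cellNode, abs_mul, abs_of_pos h0]
    have := (abs_add_le (cell a j) (node p (i j))).trans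
      (add_le_add (abs_cell_le a j) (abs_node_le p (i j)))
    gcongr
  obtain ⟨Φ, hΦ1, hΦ2, hΦ3⟩ := exists_feedForward_cellApprox h M p n hA (by positivity)
  have hdepth : (d : ℝ) * p * (n + 2) ≤ c₄ * S ^ 3 := by
    have h1 : (n : ℝ) + 2 ≤ (c₃ + κ + 3) * S ^ 2 := by linarith
    calc (d : ℝ) * p * (n + 2) ≤ d * ((c₂ + 1) * S) * ((c₃ + κ + 3) * S ^ 2) := by gcongr
      _ = c₄ * S ^ 3 := by rw [hc₄]; ring
  have hS3 : 1 ≤ S ^ 3 := one_le_pow₀ hS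
  refine ⟨Φ, ?_, ?_, fun x => ?_⟩
  · have h1 : (Φ.size : ℝ) ≤ (2 * M + 1) ^ d * p ^ d * ((d * p * (n + 2) + 1) *
        ((2 * d + 8) * (2 * d + 8) + (2 * d + 8))) := by exact_mod_cast hΦ2
    have h2 : (d : ℝ) * p * (n + 2) + 1 ≤ (c₄ + 1) * S ^ 3 := by linarith
    have h3 : 2 * (M : ℝ) + 1 ≤ (2 * c₁ + 1) * S := by linarith
    have h4 : (Φ.size : ℝ) ≤ c₅ * S ^ (2 * d + 3) := by
      refine h1.trans ?_
      calc ((2 * M + 1) ^ d * p ^ d * ((d * p * (n + 2) + 1) *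
            ((2 * d + 8) * (2 * d + 8) + (2 * d + 8))) : ℝ)
          ≤ ((2 * c₁ + 1) * S) ^ d * ((c₂ + 1) * S) ^ d * (((c₄ + 1) * S ^ 3) *
            ((2 * d + 8) * (2 * d + 8) + (2 * d + 8))) := by gcongr
        _ = c₅ * S ^ (2 * d + 3) := by rw [hc₅, mul_pow, mul_pow]; ring
    exact h4.trans (mul_le_mul_of_nonneg_right (by linarith) (by positivity))
  · rw [hΦ1]
    push_cast
    exact hdepth.trans (mul_le_mul_of_nonneg_right (by linarith) (by positivity))
  · have hW0 : 0 < expWeight α x := Real.exp_pos _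
    have h1 := abs_sub_cellApprox_le hFβ hFf hb.le hFb hα0.le hfb hj₀ h0 hhr M p x
    have h2 : Real.exp (-(α * (M * h))) ≤ Real.exp (-(κ * S)) := Real.exp_le_exp.2 (by linarith)
    have h3 : Real.exp (4 * p) ^ d * (Real.exp (4 * p) *
        (Real.exp (d * ((r + α) * ((M + 1) * h) + r ^ 2)) * (2 / (r / h)) ^ p)) ≤
          Real.exp (-(κ * S)) := 
      interpolation_error_le hr0 hα0 h0 hh hc₂ hS hMS hp2
    have h4 : |cellApprox f h M p x - Φ.realize relu x 0| ≤ B β * Real.exp (-(κ * S)) := by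
      refine (hΦ3 x).trans ?_
      exact network_error_le hb.le hκ h0 hc₁0 hc₂0 hc₃ hS hMS hM1 hp1 hn2
    have hE := one_le_exp_mul_expWeight α x
    have h5 : B β * Real.exp (-(κ * S)) ≤
        B β * Real.exp (-(κ * S)) * (Real.exp (d * α ^ 2) * expWeight α x) :=
      le_mul_of_one_le_right (by positivity) hE
    calc |f x - Φ.realize relu x 0|
        ≤ |f x - cellApprox f h M p x| + |cellApprox f h M p x - Φ.realize relu x 0| :=
          abs_sub_le _ _ _
      _ ≤ (B β * Real.exp (-(α * (M * h))) + 2 * d * B β * (Real.exp (4 * p) ^ d *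
          (Real.exp (4 * p) * (Real.exp (d * ((r + α) * ((M + 1) * h) + r ^ 2)) *
            (2 / (r / h)) ^ p)))) * expWeight α x +
          B β * Real.exp (-(κ * S)) * (Real.exp (d * α ^ 2) * expWeight α x) := by
          refine add_le_add (h1.trans (le_of_eq ?_)) (h4.trans h5)
          ring
      _ ≤ (B β * Real.exp (-(κ * S)) + 2 * d * B β * Real.exp (-(κ * S))) * expWeight α x +
          B β * Real.exp (-(κ * S)) * (Real.exp (d * α ^ 2) * expWeight α x) := by gcongr
      _ = c₆ * Real.exp (-(κ * S)) * expWeight α x := by rw [hc₆]; ring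
      _ ≤ (c₄ + c₅ + c₆) * Real.exp (-(κ * S)) * expWeight α x := by
          gcongr
          linarith

theorem theorem4p6 (d : ℕ) (hd : 0 < d) (β : Fin d → ℝ) (hβ : ∀ j, 0 < β j) (b : ℝ) :
    ∃ C : ℝ, 0 < C ∧
      ∀ (τ : Fin d → ℝ) (B : (Fin d → ℝ) → ℝ) (f : (Fin d → ℝ) → ℝ),
        AnalyticWithGrowth τ B f → (∀ j, β j < τ j) → B β = b →
        ∀ N : ℕ, 1 ≤ N →
          ∃ Φ : FeedForward 1 d,
            (Φ.size : ℝ) ≤ C * N * (1 + Real.log N) ∧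
            (Φ.depth : ℝ) ≤
              C * (N : ℝ) ^ (3 / (2 * (d : ℝ) + 7)) * (1 + Real.log N) ^ 2 ∧
            eLpNorm (fun x => f x - Φ.realize relu x 0) 2 (stdGaussianMeasure d) ≤
              ENNReal.ofReal (C * Real.exp (-((2 : ℝ) ^ (-(1 / 2) : ℝ) * geomMean β *
                (N : ℝ) ^ (1 / (2 * (d : ℝ) + 7))))) := by
  -- For `b ≤ 0` nothing is claimed, as `B β` is positive.
  rcases le_or_gt b 0 with hb | hb
  · refine ⟨1, one_pos, fun τ B f hf hβτ hB => ?_⟩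
    obtain ⟨-, F, -, -, h⟩ := hf
    have := (h β (fun j => (hβ j).le) fun j => (hβτ j).le).1
    linarith
  have hκ : 0 ≤ (2 : ℝ) ^ (-(1 / 2) : ℝ) * geomMean β := by
    have : 0 ≤ ∏ j, β j := Finset.prod_nonneg fun j _ => (hβ j).le
    unfold geomMean
    positivity
  obtain ⟨α, hα, C, hC, hmain⟩ := exists_feedForward_abs_sub_le hd hβ hb hκ
  set K := (eLpNorm (expWeight α) 2 (stdGaussianMeasure d)).toReal with hK
  have hK0 : 0 ≤ K := ENNReal.toReal_nonneg
  refine ⟨C * (K + 1), by positivity, fun τ B f hf hβτ hB N hN => ?_⟩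
  have hN1 : (1 : ℝ) ≤ N := by exact_mod_cast hN
  have hlog : 0 ≤ Real.log N := Real.log_nonneg hN1
  have hd7 : (0 : ℝ) < 2 * d + 7 := by positivity
  set S := (N : ℝ) ^ (1 / (2 * (d : ℝ) + 7)) with hS
  have hS1 : 1 ≤ S := Real.one_le_rpow hN1 (by positivity)
  have hCK : C ≤ C * (K + 1) := le_mul_of_one_le_right hC.le (by linarith)
  obtain ⟨Φ, h1, h2, h3⟩ := hmain τ B f hf hβτ hB S hS1
  refine ⟨Φ, ?_, ?_, ?_⟩
  · have h4 : S ^ (2 * d + 7) = N := by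
      rw [hS, ← Real.rpow_natCast, ← Real.rpow_mul (by positivity)]
      push_cast
      rw [one_div_mul_cancel hd7.ne', Real.rpow_one]
    have h5 : S ^ (2 * d + 3) ≤ N := by
      rw [← h4]
      exact pow_le_pow_right₀ hS1 (by omega)
    calc (Φ.size : ℝ) ≤ C * S ^ (2 * d + 3) := h1
      _ ≤ C * (K + 1) * N := by gcongr
      _ ≤ C * (K + 1) * N * (1 + Real.log N) :=
        le_mul_of_one_le_right (by positivity) (by linarith)
  · have h4 : S ^ 3 = (N : ℝ) ^ (3 / (2 * (d : ℝ) + 7)) := by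
      rw [hS, ← Real.rpow_natCast, ← Real.rpow_mul (by positivity)]
      congr 1
      push_cast
      ring
    calc (Φ.depth : ℝ) ≤ C * S ^ 3 := h2
      _ ≤ C * (K + 1) * (N : ℝ) ^ (3 / (2 * (d : ℝ) + 7)) := by rw [h4]; gcongr
      _ ≤ _ := le_mul_of_one_le_right (by positivity) (one_le_pow₀ (by linarith))
  · set D := C * Real.exp (-((2 : ℝ) ^ (-(1 / 2) : ℝ) * geomMean β * S)) with hD
    have hD0 : 0 ≤ D := by positivity
    calc eLpNorm (fun x => f x - Φ.realize relu x 0) 2 (stdGaussianMeasure d)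
        ≤ eLpNorm (D • expWeight α) 2 (stdGaussianMeasure d) :=
          eLpNorm_mono_real fun x => by simpa using h3 x
      _ = ENNReal.ofReal D * ENNReal.ofReal K := by
          rw [eLpNorm_const_smul, hK, ENNReal.ofReal_toReal (eLpNorm_expWeight_lt_top hα d).ne,
            Real.enorm_eq_ofReal hD0]
      _ = ENNReal.ofReal (D * K) := (ENNReal.ofReal_mul hD0).symm
      _ ≤ _ := by
          refine ENNReal.ofReal_le_ofReal ?_
          rw [hD, mul_right_comm]
          gcongr
          linarith
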